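/- Write $\langle\xi\rangle=(1+|\xi|^2)^{1/2}$ for $\xi\in\mathbb R^2$, let $m\in\mathbb R$ and $L>0$. Let $a\in C^\infty(\mathbb R^2\times\mathbb R^2;\mathbb C)$ be a classical symbol of order $m$ on the periodized unit square: $a(x,\xi)$ is $1$-periodic in $x_1$ and in $x_2$, and there are smooth functions $a_j(x,\theta)$ $(j\ge 0)$, $1$-periodic in $x_1,x_2$ and $2\pi$-periodic in $\theta$, with $a(x,\xi)\sim\sum_{j\ge0}a_j(x,\arg\xi)\,|\xi|^{m-j}$. This means that for every $J\ge 0$ the function $r_J=a-\sum_{j<J}\chi(|\xi|)\,a_j(x,\arg\xi)\,|\xi|^{m-j}$ belongs to $S^{m-J}$, that is, it is smooth and $|\partial_\xi^\alpha\partial_x^\beta r_J(x,\xi)|\le C_{J,\alpha,\beta}\langle\xi\rangle^{m-J-|\alpha|}$ for all multi-indices $\alpha,\beta$; here $\chi$ is a smooth cutoff with $\chi(r)=0$ for $r\le1$ and $\chi(r)=1$ for $r\ge2$. Assume that the $a_j$ have tempered growth: there are $R>0$ and constants $Q_{\alpha,\beta}$ with $|\partial_\theta^\alpha\partial_x^\beta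 a_j(x,\theta)|\le Q_{\alpha,\beta}R^j$ for all $\alpha,\beta,j,x,\theta$. Let $T_n$ be the Chebyshev polynomials of the first kind, $TL_n(r)=T_n\!\left(\frac{r-L}{r+L}\right)$, $A_L(s)=L\frac{1+s}{1-s}$, $h_\lambda(\xi)=\langle\xi\rangle^{-m}\int_{[0,1]^2}a(x,\xi)e^{-2\pi i x\cdot\lambda}\,dx$ for $\lambda\in\mathbb Z^2$, and for $k\in\mathbb Z$, $n\ge0$, with $c_0=1/\pi$ and $c_n=2/\pi$ for $n\ge1$, $$a_{\lambda,(k,n)}=\frac{c_n}{2\pi}\int_{-1}^1\int_0^{2\pi}h_\lambda\big(A_L(s)\cos\theta,A_L(s)\sin\theta\big)\,e^{-ik\theta}\,T_n(s)\,\frac{d\theta\,ds}{\sqrt{1-s^2}}.$$ For a finite set $S\subset\mathbb Z^2\times\mathbb Z\times\mathbb N$ let $$\tilde a_S(x,\xi)=\sum_{(\lambda,k,n)\in S}a_{\lambda,(k,n)}\,e^{2\pi i x\cdot\lambda}\,e^{ik\arg\xi}\,TL_n(|\xi|)\,\langle\xi\rangle^{m}$$ (with the convention $\arg 0=0$) be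 the expansion of $a$ truncated to the terms indexed by $S$. Let $H^m([0,1]^2)$ be the periodic Sobolev space with norm $\|f\|_{H^m}^2=\sum_{\xi\in\mathbb Z^2}\langle\xi\rangle^{2m}|\hat f(\xi)|^2$, where $\hat f(\xi)$ are the Fourier series coefficients, and let $A$ and $\tilde A_S$ be the periodic pseudodifferential operators $f\mapsto\sum_{\xi\in\mathbb Z^2}e^{2\pi i x\cdot\xi}a(x,\xi)\hat f(\xi)$ and $f\mapsto\sum_{\xi\in\mathbb Z^2}e^{2\pi i x\cdot\xi}\tilde a_S(x,\xi)\hat f(\xi)$, the sums converging unconditionally in $L^2([0,1]^2)$. Then $A$ is a bounded operator from $H^m([0,1]^2)$ to $L^2([0,1]^2)$, and there are constants $C_n>0$ $(n>0)$, independent of $\varepsilon$, such that for every $\varepsilon>0$ there are an integer $M\ge 0$ with $$M\le C_n\,\varepsilon^{-1/n}\qquad\text{for all } n>0,$$ and a set $S$ of at most $M$ indices for which $\tilde A_S$ is bounded from $H^m([0,1]^2)$ to $L^2([0,1]^2)$ and $$\|\tilde A_S-A\|_{H^m([0,1]^2)\to L^2([0,1]^2)}\le\varepsilon .$$ -/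

import Mathlib

open scoped ContDiff

noncomputable section

namespace SymbolCalculus

/-- The Euclidean plane, for the space variable `x` and for the frequency variable `ξ`. -/
abbrev Plane : Type := EuclideanSpace ℝ (Fin 2)

/-- The frequency lattice `ℤ²`. -/
abbrev Lattice : Type := Fin 2 → ℤ

/-- A lattice frequency as a point of the plane. -/
def Lattice.toPlane (k : Lattice) : Plane := WithLp.toLp 2 (fun i => (k i : ℝ))

/-- The Japanese bracket `⟨ξ⟩ = (1 + |ξ|²)^{1/2}`. -/
def bracket (ξ : Plane) : ℝ := Real.sqrt (1 + ‖ξ‖ ^ 2)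

theorem bracket_pos (ξ : Plane) : 0 < bracket ξ := Real.sqrt_pos.2 (by positivity)

/-- The polar angle `arg ξ` (in `(-π, π]`, and `0` at the origin). -/
def polarArg (ξ : Plane) : ℝ := Complex.arg ⟨ξ 0, ξ 1⟩

/-- The point with polar coordinates `(θ, r)`. -/
def polarPoint (θ r : ℝ) : Plane := !₂[r * Real.cos θ, r * Real.sin θ]

/-! ### Symbols -/

/-- `∂/∂x_i` of a function of `x` and of a further variable. -/
def partialX {Y : Type*} (i : Fin 2) (a : Plane → Y → ℂ) : Plane → Y → ℂ :=
  fun x y => fderiv ℝ (fun x' => a x' y) x (EuclideanSpace.single i 1)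

/-- `∂/∂ξ_i` of a function of `(x, ξ)`. -/
def partialXi (i : Fin 2) (a : Plane → Plane → ℂ) : Plane → Plane → ℂ :=
  fun x ξ => fderiv ℝ (fun ξ' => a x ξ') ξ (EuclideanSpace.single i 1)

/-- `∂/∂θ` of a function of `(x, θ)`. -/
def partialTheta (b : Plane → ℝ → ℂ) : Plane → ℝ → ℂ :=
  fun x θ => deriv (fun θ' => b x θ') θ

/-- `∂_x^β` for a multi-index `β`. -/
def derivX {Y : Type*} (β : Fin 2 → ℕ) (a : Plane → Y → ℂ) : Plane → Y → ℂ :=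
  (partialX 0)^[β 0] ((partialX 1)^[β 1] a)

/-- `∂_ξ^α` for a multi-index `α`. -/
def derivXi (α : Fin 2 → ℕ) (a : Plane → Plane → ℂ) : Plane → Plane → ℂ :=
  (partialXi 0)^[α 0] ((partialXi 1)^[α 1] a)

/-- `∂_θ^α` for a natural number `α`. -/
def derivTheta (α : ℕ) (b : Plane → ℝ → ℂ) : Plane → ℝ → ℂ := partialTheta^[α] b

/-- The class `S^m` (type `(1,0)`): smooth, with
`|∂_ξ^α ∂_x^β a(x,ξ)| ≤ C_{αβ} ⟨ξ⟩^{m-|α|}`. -/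
def IsSymbol (m : ℝ) (a : Plane → Plane → ℂ) : Prop :=
  ContDiff ℝ ∞ (fun p : Plane × Plane => a p.1 p.2) ∧
    ∀ α β : Fin 2 → ℕ, ∃ C : ℝ, ∀ x ξ : Plane,
      ‖derivXi α (derivX β a) x ξ‖ ≤ C * bracket ξ ^ (m - ((α 0 + α 1 : ℕ) : ℝ))

/-- One-periodicity in each coordinate of `x`: the space domain is the periodized unit square. -/
def PeriodicInX {Y : Type*} (a : Plane → Y → ℂ) : Prop :=
  ∀ (i : Fin 2) (x : Plane) (y : Y), a (x + EuclideanSpace.single i 1) y = a x y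

/-- A smooth radial cutoff: `0` for `r ≤ 1`, and `1` for `r ≥ 2`. -/
def radialCutoff (r : ℝ) : ℝ := Real.smoothTransition (r - 1)

/-- The term `a_j(x, arg ξ) |ξ|^{m-j}` of a polyhomogeneous series, cut off near the origin;
`b` is the coefficient function `a_j`. -/
def homogeneousTerm (m : ℝ) (j : ℕ) (b : Plane → ℝ → ℂ) : Plane → Plane → ℂ :=
  fun x ξ => ((radialCutoff ‖ξ‖ * ‖ξ‖ ^ (m - (j : ℝ)) : ℝ) : ℂ) * b x (polarArg ξ)

/-- `a` is a classical symbol of order `m` on the periodized square, with polyhomogeneous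
components `b j`: these are smooth functions of `x` (in the periodized square) and of the
angle, and `a ~ ∑_j b_j(x, arg ξ) |ξ|^{m-j}`, that is, the difference of `a` and the first `J`
terms is a symbol of order `m - J`, for every `J` (for `J = 0`: `a` is in `S^m`). -/
structure IsClassicalSymbol (m : ℝ) (a : Plane → Plane → ℂ) (b : ℕ → Plane → ℝ → ℂ) : Prop where
  periodic : PeriodicInX a
  smooth_component : ∀ j, ContDiff ℝ ∞ (fun p : Plane × ℝ => b j p.1 p.2)
  periodic_component : ∀ j, PeriodicInX (b j)
  angular_component : ∀ j x, Function.Periodic (b j x) (2 * Real.pi)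
  expansion : ∀ J : ℕ, IsSymbol (m - (J : ℝ))
    (fun x ξ => a x ξ - ∑ j ∈ Finset.range J, homogeneousTerm m j (b j) x ξ)

/-- Tempered growth: `|∂_θ^α ∂_x^β b_j(x, θ)| ≤ Q_{αβ} R^j`, with `R` independent of the
orders of differentiation. -/
def TemperedGrowth (b : ℕ → Plane → ℝ → ℂ) : Prop :=
  ∃ (Q : ℕ → (Fin 2 → ℕ) → ℝ) (R : ℝ), 0 < R ∧
    ∀ (α : ℕ) (β : Fin 2 → ℕ) (j : ℕ) (x : Plane) (θ : ℝ),
      ‖derivTheta α (derivX β (b j)) x θ‖ ≤ Q α β * R ^ j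

/-! ### The rational Chebyshev expansion -/

/-- The unit square `[0,1]²`. -/
def unitSquare : Set Plane := {x | ∀ i, x i ∈ Set.Icc (0 : ℝ) 1}

/-- The complex exponential `e^{2 π i x · k}`. -/
def planeWave (k : Lattice) (x : Plane) : ℂ :=
  Complex.exp (2 * Real.pi * Complex.I * ((∑ i, (k i : ℝ) * x i : ℝ) : ℂ))

/-- `h_λ(ξ) = ⟨ξ⟩^{-m} ∫_{[0,1]²} a(x,ξ) e^{-2 π i x · λ} dx`. -/
def fourierSymbol (m : ℝ) (a : Plane → Plane → ℂ) (l : Lattice) (ξ : Plane) : ℂ :=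
  ((bracket ξ ^ (-m) : ℝ) : ℂ) * ∫ x in unitSquare, a x ξ * planeWave (-l) x

/-- The algebraic map `A_L(s) = L (1 + s) / (1 - s)` of `[-1, 1)` onto `[0, ∞)`. -/
def algebraicMap (L s : ℝ) : ℝ := L * (1 + s) / (1 - s)

/-- The Chebyshev polynomial of the first kind `T_n(s)`. -/
def chebT (n : ℕ) (s : ℝ) : ℝ := (Polynomial.Chebyshev.T ℝ (n : ℤ)).eval s

/-- The rational Chebyshev function `TL_n(r) = T_n((r - L)/(r + L))`. -/
def ratCheb (L : ℝ) (n : ℕ) (r : ℝ) : ℝ := chebT n ((r - L) / (r + L))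

/-- `g_{(k,n)}(ξ) = e^{i k arg ξ} TL_n(|ξ|)`. -/
def freqBasis (L : ℝ) (k : ℤ) (n : ℕ) (ξ : Plane) : ℂ :=
  Complex.exp (Complex.I * (k : ℂ) * (polarArg ξ : ℂ)) * (ratCheb L n ‖ξ‖ : ℂ)

/-- The normalization of the Chebyshev coefficients: the inverse of
`∫_{-1}^1 T_n(s)² ds / √(1 - s²)`. -/
def chebNormalization (n : ℕ) : ℝ := if n = 0 then 1 / Real.pi else 2 / Real.pi

/-- The entry `a_{λ,(k,n)}` of the interaction matrix: the coefficient of `h_λ` along `g_{(k,n)}`,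
`(c_n / 2π) ∫_{-1}^1 ∫_0^{2π} h_λ(θ, A_L(s)) e^{-i k θ} T_n(s) dθ ds / √(1 - s²)`. -/
def interactionCoeff (m L : ℝ) (a : Plane → Plane → ℂ) (l : Lattice) (k : ℤ) (n : ℕ) : ℂ :=
  ((chebNormalization n / (2 * Real.pi) : ℝ) : ℂ) *
    ∫ s in (-1 : ℝ)..1, ∫ θ in (0 : ℝ)..(2 * Real.pi),
      fourierSymbol m a l (polarPoint θ (algebraicMap L s)) *
        Complex.exp (-(Complex.I * (k : ℂ) * (θ : ℂ))) *
        ((chebT n s / Real.sqrt (1 - s ^ 2) : ℝ) : ℂ)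

/-- The rational Chebyshev expansion of `a` in which only the entries of the interaction matrix
with index in `S` are kept:
`∑_{(λ,k,n) ∈ S} a_{λ,(k,n)} e^{2 π i x · λ} g_{(k,n)}(ξ) ⟨ξ⟩^m`. -/
def truncatedExpansion (m L : ℝ) (a : Plane → Plane → ℂ) (S : Finset (Lattice × ℤ × ℕ)) :
    Plane → Plane → ℂ :=
  fun x ξ => ∑ p ∈ S, interactionCoeff m L a p.1 p.2.1 p.2.2 * planeWave p.1 x *
    freqBasis L p.2.1 p.2.2 ξ * ((bracket ξ ^ m : ℝ) : ℂ)

/-! ### Periodic Sobolev spaces and pseudodifferential operators -/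

/-- The families of Fourier coefficients `c` with `∑_ξ ⟨ξ⟩^{2m} |c_ξ|² < ∞`. -/
def sobolevSubmodule (m : ℝ) : Submodule ℂ (Lattice → ℂ) where
  carrier := {c | Memℓp (fun k : Lattice => ((bracket k.toPlane ^ m : ℝ) : ℂ) * c k) 2}
  zero_mem' := by
    have h : Memℓp (0 : Lattice → ℂ) 2 := zero_memℓp
    have e : (fun k : Lattice => ((bracket k.toPlane ^ m : ℝ) : ℂ) * (0 : Lattice → ℂ) k) = 0 := by
      funext k; simp
    simpa only [Set.mem_ofPred_eq, e] using h
  add_mem' := by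
    intro c d hc hd
    have h := Memℓp.add hc hd
    have e : (fun k : Lattice => ((bracket k.toPlane ^ m : ℝ) : ℂ) * (c + d) k) =
        (fun k : Lattice => ((bracket k.toPlane ^ m : ℝ) : ℂ) * c k) +
          (fun k : Lattice => ((bracket k.toPlane ^ m : ℝ) : ℂ) * d k) := by
      funext k; simp [mul_add]
    simpa only [Set.mem_ofPred_eq, e] using h
  smul_mem' := by
    intro z c hc
    have h := Memℓp.const_smul hc z
    have e : (fun k : Lattice => ((bracket k.toPlane ^ m : ℝ) : ℂ) * (z • c) k) =
        z • (fun k : Lattice => ((bracket k.toPlane ^ m : ℝ) : ℂ) * c k) := by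
      funext k; simp [mul_left_comm]
    simpa only [Set.mem_ofPred_eq, e] using h

/-- The periodic Sobolev space `H^m([0,1]²)` of real order `m`; a periodic function (a periodic
distribution when `m < 0`) is given by the family of its Fourier coefficients. -/
def SobolevSpace (m : ℝ) : Type := ↥(sobolevSubmodule m)

instance (m : ℝ) : AddCommGroup (SobolevSpace m) :=
  inferInstanceAs (AddCommGroup ↥(sobolevSubmodule m))

instance (m : ℝ) : Module ℂ (SobolevSpace m) :=
  inferInstanceAs (Module ℂ ↥(sobolevSubmodule m))

/-- The Fourier coefficient of index `k`. -/
def SobolevSpace.coeff {m : ℝ} (f : SobolevSpace m) (k : Lattice) : ℂ := f.1 k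

/-- The map `f ↦ (⟨ξ⟩^m f̂(ξ))_ξ` into `ℓ²(ℤ²)`. -/
def SobolevSpace.toL2 (m : ℝ) : SobolevSpace m →ₗ[ℂ] lp (fun _ : Lattice => ℂ) 2 where
  toFun f := ⟨fun k : Lattice => ((bracket k.toPlane ^ m : ℝ) : ℂ) * f.1 k, f.2⟩
  map_add' f g := by
    ext k
    exact mul_add _ _ _
  map_smul' z f := by
    ext k
    exact mul_left_comm _ _ _

theorem SobolevSpace.toL2_injective (m : ℝ) : Function.Injective (SobolevSpace.toL2 m) := by
  intro f g h
  apply Subtype.ext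
  funext k
  have hk : ((bracket k.toPlane ^ m : ℝ) : ℂ) * f.1 k = ((bracket k.toPlane ^ m : ℝ) : ℂ) * g.1 k :=
    congrArg (fun u : lp (fun _ : Lattice => ℂ) 2 => (u : Lattice → ℂ) k) h
  refine mul_left_cancel₀ ?_ hk
  exact Complex.ofReal_ne_zero.2 (Real.rpow_pos_of_pos (bracket_pos _) m).ne'

/-- The norm of `H^m`: `‖f‖² = ∑_ξ ⟨ξ⟩^{2m} |f̂(ξ)|²`. -/
instance (m : ℝ) : NormedAddCommGroup (SobolevSpace m) :=
  NormedAddCommGroup.induced (SobolevSpace m) (lp (fun _ : Lattice => ℂ) 2)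
    (SobolevSpace.toL2 m) (SobolevSpace.toL2_injective m)

instance (m : ℝ) : NormedSpace ℂ (SobolevSpace m) :=
  NormedSpace.induced ℂ (SobolevSpace m) (lp (fun _ : Lattice => ℂ) 2) (SobolevSpace.toL2 m)

/-- `L²([0,1]²)`. -/
abbrev SquareL2 : Type :=
  MeasureTheory.Lp ℂ 2 (MeasureTheory.volume.restrict unitSquare : MeasureTheory.Measure Plane)

/-- `A : H^m → L²` is the periodic pseudodifferential operator `a(x,D)`:
`A f(x) = ∑_{ξ ∈ ℤ²} e^{2 π i x · ξ} a(x,ξ) f̂(ξ)` for every `f` in `H^m`, the sum converging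
unconditionally in `L²([0,1]²)`. -/
def IsPseudodifferential (m : ℝ) (a : Plane → Plane → ℂ) (A : SobolevSpace m →L[ℂ] SquareL2) :
    Prop :=
  ∀ f : SobolevSpace m, ∃ t : Lattice → SquareL2,
    (∀ k : Lattice, (t k : Plane → ℂ)
      =ᵐ[MeasureTheory.volume.restrict unitSquare]
        fun x => planeWave k x * a x k.toPlane * f.coeff k) ∧
    HasSum t (A f)

end SymbolCalculus

end

noncomputable section

namespace SymbolCalculus

open MeasureTheory Set Filter Topology

/-! Divide the symbol by ⟨ξ⟩^m and write ξ in polar coordinates with |ξ| = A_L(s). The quotient is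
smooth and 1-periodic in x and 2π-periodic in θ. In s it is smooth up to s = 1, the circle at
infinity: subtracting n homogeneous terms leaves a remainder whose normalization is of order -n,
each s-derivative costs one power of ⟨ξ⟩, and the normalized terms are smooth in 1/|ξ| =
(1-s)/(L(1+s)). At the origin, s = -1 is no boundary either, because (θ, r) ↦ ξ is smooth through r
= 0 and s may run below -1. All this is `IsClassicalSymbol.unifBdd_ray`.

Smoothness gives rapid decay of a_{λ,(k,n)} in each index: integration by parts against exponentials
for λ and k, and, after s = cos φ, against the Sturm-Liouville operator of the T_n for n. Hence
`IsClassicalSymbol.exists_cosineMoment_decay`. The coefficients are absolutely summable, so the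
expansion converges to the symbol (`IsClassicalSymbol.hasSum_expansion`).

For operators, each term e^{2πi x·λ} g_{(k,n)}(ξ) ⟨ξ⟩^m defines a contraction H^m → L²: an isometry
into ℓ², a multiplier bounded by 1, and a synthesis along shifted orthonormal waves. Thus A is a
norm-convergent series of multiples of contractions, and the truncation error is at most the ℓ¹ norm
of the discarded coefficients.

A box of side K holds O(K⁴) indices and leaves a tail O(K^{-N}) for every N, so O(ε^{-1/n}) indices
suffice for each n separately. One set serving all n at once is a set of least cardinality among
those with tail at most ε (`exists_sparse_approximation`). -/

/-- Uniform weighted control of a family of functions on `D` and of its derivatives up to order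
`n`: the `j`-th derivative is `O(w ^ (q + j δ))`, uniformly in the index. -/
def Ctrl {ι : Type*} (D : Set ℝ) (w : ι → ℝ → ℝ) (δ : ℝ) : ℕ → ℝ → (ι → ℝ → ℂ) → Prop
  | 0, q, f => ∃ C : ℝ, ∀ i, ∀ t ∈ D, ‖f i t‖ ≤ C * w i t ^ q
  | n + 1, q, f => (∃ C : ℝ, ∀ i, ∀ t ∈ D, ‖f i t‖ ≤ C * w i t ^ q) ∧
      ∃ f' : ι → ℝ → ℂ, (∀ i, ∀ t ∈ D, HasDerivAt (f i) (f' i t) t) ∧ Ctrl D w δ n (q + δ) f'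

/-- Uniform boundedness of a family of functions on `D` and of its derivatives up to order `n`. -/
abbrev UnifBdd {ι : Type*} (D : Set ℝ) (n : ℕ) (f : ι → ℝ → ℂ) : Prop :=
  Ctrl D (fun _ _ => 1) 0 n 0 f

/-! ### Calculus of uniformly controlled families -/

section Ctrl

variable {ι κ : Type*} {D : Set ℝ} {w : ι → ℝ → ℝ} {δ : ℝ}

theorem Ctrl.bound {n : ℕ} {q : ℝ} {f : ι → ℝ → ℂ} (h : Ctrl D w δ n q f) :
    ∃ C : ℝ, ∀ i, ∀ t ∈ D, ‖f i t‖ ≤ C * w i t ^ q := by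
  cases n with
  | zero => exact h
  | succ n => exact h.1

theorem Ctrl.bound_nonneg {n : ℕ} {q : ℝ} {f : ι → ℝ → ℂ} (hw : ∀ i t, 1 ≤ w i t)
    (h : Ctrl D w δ n q f) : ∃ C : ℝ, 0 ≤ C ∧ ∀ i, ∀ t ∈ D, ‖f i t‖ ≤ C * w i t ^ q := by
  obtain ⟨C, hC⟩ := h.bound
  refine ⟨max C 0, le_max_right _ _, fun i t ht => (hC i t ht).trans ?_⟩
  have : 0 ≤ w i t ^ q := Real.rpow_nonneg (by linarith [hw i t]) _
  gcongr
  exact le_max_left _ _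

theorem Ctrl.pred {n : ℕ} : ∀ {q : ℝ} {f : ι → ℝ → ℂ}, Ctrl D w δ (n + 1) q f →
    Ctrl D w δ n q f := by
  induction n with
  | zero => exact fun h => h.1
  | succ n ih =>
    rintro q f ⟨hb, f', hd, h'⟩
    exact ⟨hb, f', hd, ih h'⟩

theorem Ctrl.congr {n : ℕ} {q : ℝ} {f g : ι → ℝ → ℂ} (hD : IsOpen D)
    (h : Ctrl D w δ n q f) (hfg : ∀ i, ∀ t ∈ D, f i t = g i t) : Ctrl D w δ n q g := by
  cases n with
  | zero =>
    obtain ⟨C, hC⟩ := h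
    exact ⟨C, fun i t ht => hfg i t ht ▸ hC i t ht⟩
  | succ n =>
    obtain ⟨⟨C, hC⟩, f', hd, h'⟩ := h
    refine ⟨⟨C, fun i t ht => hfg i t ht ▸ hC i t ht⟩, f', fun i t ht => ?_, h'⟩
    refine (hd i t ht).congr_of_eventuallyEq ?_
    filter_upwards [hD.mem_nhds ht] with s hs using (hfg i s hs).symm

theorem Ctrl.mono_set {D' : Set ℝ} (hD : D' ⊆ D) {n : ℕ} :
    ∀ {q : ℝ} {f : ι → ℝ → ℂ}, Ctrl D w δ n q f → Ctrl D' w δ n q f := by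
  induction n with
  | zero => exact fun ⟨C, hC⟩ => ⟨C, fun i t ht => hC i t (hD ht)⟩
  | succ n ih =>
    rintro q f ⟨⟨C, hC⟩, f', hd, h'⟩
    exact ⟨⟨C, fun i t ht => hC i t (hD ht)⟩, f', fun i t ht => hd i t (hD ht), ih h'⟩

theorem Ctrl.reindex (g : κ → ι) {n : ℕ} :
    ∀ {q : ℝ} {f : ι → ℝ → ℂ}, Ctrl D w δ n q f →
      Ctrl D (fun k => w (g k)) δ n q (fun k => f (g k)) := by
  induction n with
  | zero => exact fun ⟨C, hC⟩ => ⟨C, fun i t ht => hC (g i) t ht⟩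
  | succ n ih =>
    rintro q f ⟨⟨C, hC⟩, f', hd, h'⟩
    exact ⟨⟨C, fun i t ht => hC (g i) t ht⟩, fun k => f' (g k), fun i t ht => hd (g i) t ht, ih h'⟩

theorem Ctrl.zero {n : ℕ} : ∀ {q : ℝ}, Ctrl D w δ n q (fun _ _ => (0 : ℂ)) := by
  induction n with
  | zero => exact ⟨0, by simp⟩
  | succ n ih => exact ⟨⟨0, by simp⟩, fun _ _ => 0, fun i t _ => hasDerivAt_const t 0, ih⟩

theorem Ctrl.const {n : ℕ} {q : ℝ} {c : ι → ℂ} {C : ℝ}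
    (hc : ∀ i, ∀ t ∈ D, ‖c i‖ ≤ C * w i t ^ q) : Ctrl D w δ n q (fun i _ => c i) := by
  cases n with
  | zero => exact ⟨C, hc⟩
  | succ n => exact ⟨⟨C, hc⟩, fun _ _ => 0, fun i t _ => hasDerivAt_const t _, Ctrl.zero⟩

theorem Ctrl.add {n : ℕ} : ∀ {q : ℝ} {f g : ι → ℝ → ℂ}, Ctrl D w δ n q f → Ctrl D w δ n q g →
    Ctrl D w δ n q (fun i t => f i t + g i t) := by
  have key : ∀ {n : ℕ} {q : ℝ} {f g : ι → ℝ → ℂ}, Ctrl D w δ n q f → Ctrl D w δ n q g →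
      ∃ C : ℝ, ∀ i, ∀ t ∈ D, ‖f i t + g i t‖ ≤ C * w i t ^ q := by
    intro n q f g hf hg
    obtain ⟨C, hC⟩ := hf.bound
    obtain ⟨C', hC'⟩ := hg.bound
    refine ⟨C + C', fun i t ht => (norm_add_le _ _).trans ?_⟩
    linarith [hC i t ht, hC' i t ht]
  induction n with
  | zero => exact fun hf hg => key hf hg
  | succ n ih =>
    intro q f g hf hg
    refine ⟨key hf hg, ?_⟩
    obtain ⟨-, f', hfd, hf'⟩ := hf
    obtain ⟨-, g', hgd, hg'⟩ := hg
    exact ⟨_, fun i t ht => (hfd i t ht).add (hgd i t ht), ih hf' hg'⟩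

theorem Ctrl.sum {α : Type*} (s : Finset α) {n : ℕ} {q : ℝ} {f : α → ι → ℝ → ℂ}
    (h : ∀ a ∈ s, Ctrl D w δ n q (f a)) : Ctrl D w δ n q (fun i t => ∑ a ∈ s, f a i t) := by
  classical
  induction s using Finset.induction_on with
  | empty => simpa using Ctrl.zero
  | insert a s ha ih =>
    simp only [Finset.sum_insert ha]
    exact (h a (Finset.mem_insert_self _ _)).add
      (ih fun b hb => h b (Finset.mem_insert_of_mem hb))

theorem Ctrl.mul (hw : ∀ i t, 1 ≤ w i t) {n : ℕ} :
    ∀ {p q : ℝ} {f g : ι → ℝ → ℂ}, Ctrl D w δ n p f → Ctrl D w δ n q g →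
      Ctrl D w δ n (p + q) (fun i t => f i t * g i t) := by
  have key : ∀ {n : ℕ} {p q : ℝ} {f g : ι → ℝ → ℂ}, Ctrl D w δ n p f → Ctrl D w δ n q g →
      ∃ C : ℝ, ∀ i, ∀ t ∈ D, ‖f i t * g i t‖ ≤ C * w i t ^ (p + q) := by
    intro n p q f g hf hg
    obtain ⟨C, hC0, hC⟩ := hf.bound_nonneg hw
    obtain ⟨C', hC0', hC'⟩ := hg.bound_nonneg hw
    refine ⟨C * C', fun i t ht => ?_⟩
    have h0 : 0 < w i t := by linarith [hw i t]
    rw [norm_mul, Real.rpow_add h0]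
    calc ‖f i t‖ * ‖g i t‖ ≤ (C * w i t ^ p) * (C' * w i t ^ q) := by
          gcongr
          · exact hC i t ht
          · exact hC' i t ht
      _ = _ := by ring
  induction n with
  | zero => exact fun hf hg => key hf hg
  | succ n ih =>
    intro p q f g hf hg
    refine ⟨key hf hg, ?_⟩
    have hf0 := hf.pred
    have hg0 := hg.pred
    obtain ⟨-, f', hfd, hf'⟩ := hf
    obtain ⟨-, g', hgd, hg'⟩ := hg
    refine ⟨_, fun i t ht => (hfd i t ht).mul (hgd i t ht), Ctrl.add ?_ ?_⟩
    · have := ih hf' hg0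
      rwa [show p + δ + q = p + q + δ by ring] at this
    · have := ih hf0 hg'
      rwa [show p + (q + δ) = p + q + δ by ring] at this

/-- Control with weights which stay bounded along the derivatives is uniform boundedness. -/
theorem Ctrl.unifBdd {n : ℕ} : ∀ {q : ℝ} {f : ι → ℝ → ℂ}, (∀ i t, 1 ≤ w i t) →
    (∀ j ≤ n, ∃ B : ℝ, ∀ i, ∀ t ∈ D, w i t ^ (q + j * δ) ≤ B) → Ctrl D w δ n q f →
    UnifBdd D n f := by
  have key : ∀ {n : ℕ} {q : ℝ} {f : ι → ℝ → ℂ}, (∀ i t, 1 ≤ w i t) →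
      (∀ j ≤ n, ∃ B : ℝ, ∀ i, ∀ t ∈ D, w i t ^ (q + j * δ) ≤ B) → Ctrl D w δ n q f →
      ∃ C : ℝ, ∀ i, ∀ t ∈ D, ‖f i t‖ ≤ C * (1 : ℝ) ^ (0 : ℝ) := by
    intro n q f hw hB h
    obtain ⟨C, hC0, hC⟩ := h.bound_nonneg hw
    obtain ⟨B, hB⟩ := hB 0 (Nat.zero_le _)
    refine ⟨C * B, fun i t ht => (hC i t ht).trans ?_⟩
    have := hB i t ht
    simp only [Nat.cast_zero, zero_mul, add_zero] at this
    simp only [Real.rpow_zero, mul_one]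
    gcongr
  induction n with
  | zero => exact fun hw hB h => key hw hB h
  | succ n ih =>
    intro q f hw hB h
    refine ⟨key hw hB h, ?_⟩
    obtain ⟨-, f', hd, h'⟩ := h
    refine ⟨f', hd, ?_⟩
    rw [add_zero]
    refine ih hw (fun j hj => ?_) h'
    obtain ⟨B, hB⟩ := hB (j + 1) (by omega)
    refine ⟨B, fun i t ht => ?_⟩
    have := hB i t ht
    rwa [show q + ((j + 1 : ℕ) : ℝ) * δ = q + δ + j * δ by push_cast; ring] at this

theorem UnifBdd.mul {n : ℕ} {f g : ι → ℝ → ℂ} (hf : UnifBdd D n f) (hg : UnifBdd D n g) :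
    UnifBdd D n (fun i t => f i t * g i t) := by
  have := Ctrl.mul (fun _ _ => le_rfl) hf hg
  rwa [add_zero] at this

theorem UnifBdd.const {n : ℕ} {c : ι → ℂ} {C : ℝ} (hc : ∀ i, ‖c i‖ ≤ C) :
    UnifBdd D n (fun i _ => c i) :=
  Ctrl.const (C := C) fun i _ _ => by simpa using hc i

theorem UnifBdd.bound {n : ℕ} {f : ι → ℝ → ℂ} (hf : UnifBdd D n f) :
    ∃ C : ℝ, 0 ≤ C ∧ ∀ i, ∀ t ∈ D, ‖f i t‖ ≤ C := by
  simpa using Ctrl.bound_nonneg (fun _ _ => le_rfl) hf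

theorem UnifBdd.exists_deriv {n : ℕ} {f : ι → ℝ → ℂ} (hf : UnifBdd D (n + 1) f) :
    ∃ f' : ι → ℝ → ℂ, (∀ i, ∀ t ∈ D, HasDerivAt (f i) (f' i t) t) ∧ UnifBdd D n f' := by
  obtain ⟨-, f', hd, h⟩ := hf
  exact ⟨f', hd, by rwa [add_zero] at h⟩

theorem UnifBdd.of_deriv {n : ℕ} {f f' : ι → ℝ → ℂ} {C : ℝ} (hC : ∀ i, ∀ t ∈ D, ‖f i t‖ ≤ C)
    (hd : ∀ i, ∀ t ∈ D, HasDerivAt (f i) (f' i t) t) (h : UnifBdd D n f') :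
    UnifBdd D (n + 1) f :=
  ⟨⟨C, by simpa using hC⟩, f', hd, by rwa [add_zero]⟩

/-- Glues the estimate near infinite frequency to the one at bounded frequencies. The derivative
witnesses on the two sets are unrelated as functions, so `deriv` is used as a common one; openness
makes it agree with each. -/
theorem UnifBdd.union {D₁ D₂ : Set ℝ} (h₁o : IsOpen D₁) (h₂o : IsOpen D₂) {n : ℕ} :
    ∀ {f : ι → ℝ → ℂ}, UnifBdd D₁ n f → UnifBdd D₂ n f → UnifBdd (D₁ ∪ D₂) n f := by
  classical
  have key : ∀ {n : ℕ} {f : ι → ℝ → ℂ}, UnifBdd D₁ n f → UnifBdd D₂ n f →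
      ∃ C : ℝ, ∀ i, ∀ t ∈ D₁ ∪ D₂, ‖f i t‖ ≤ C := by
    intro n f h₁ h₂
    obtain ⟨C₁, -, hC₁⟩ := h₁.bound
    obtain ⟨C₂, -, hC₂⟩ := h₂.bound
    refine ⟨max C₁ C₂, fun i t ht => ?_⟩
    rcases ht with ht | ht
    · exact (hC₁ i t ht).trans (le_max_left _ _)
    · exact (hC₂ i t ht).trans (le_max_right _ _)
  induction n with
  | zero =>
    intro f h₁ h₂
    obtain ⟨C, hC⟩ := key h₁ h₂
    exact ⟨C, by simpa using hC⟩
  | succ n ih =>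
    intro f h₁ h₂
    obtain ⟨C, hC⟩ := key h₁ h₂
    obtain ⟨f₁, hd₁, h₁'⟩ := h₁.exists_deriv
    obtain ⟨f₂, hd₂, h₂'⟩ := h₂.exists_deriv
    refine UnifBdd.of_deriv hC (f' := fun i => deriv (f i)) (fun i t ht => ?_) (ih ?_ ?_)
    · rcases ht with ht | ht
      · exact (hd₁ i t ht).differentiableAt.hasDerivAt
      · exact (hd₂ i t ht).differentiableAt.hasDerivAt
    · exact h₁'.congr h₁o fun i t ht => (hd₁ i t ht).deriv.symm
    · exact h₂'.congr h₂o fun i t ht => (hd₂ i t ht).deriv.symm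

/-- A smooth function and its derivatives are bounded on subsets of a compact set. -/
theorem unifBdd_of_contDiffOn {U K : Set ℝ} (hU : IsOpen U) (hK : IsCompact K) (hKU : K ⊆ U)
    (hDK : D ⊆ K) {n : ℕ} : ∀ {f : ℝ → ℂ}, ContDiffOn ℝ ∞ f U →
      UnifBdd D n (fun (_ : ι) t => f t) := by
  have key : ∀ {f : ℝ → ℂ}, ContDiffOn ℝ ∞ f U → ∃ C, ∀ t ∈ D, ‖f t‖ ≤ C := by
    intro f hf
    obtain ⟨C, hC⟩ := hK.exists_bound_of_continuousOn (hf.continuousOn.mono hKU)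
    exact ⟨C, fun t ht => hC t (hDK ht)⟩
  induction n with
  | zero =>
    intro f hf
    obtain ⟨C, hC⟩ := key hf
    exact ⟨C, by simpa using fun _ => hC⟩
  | succ n ih =>
    intro f hf
    obtain ⟨C, hC⟩ := key hf
    have h := (contDiffOn_infty_iff_deriv_of_isOpen hU).1 hf
    exact UnifBdd.of_deriv (fun _ => hC) (f' := fun _ => deriv f)
      (fun _ t ht => (h.1.differentiableAt (hU.mem_nhds (hKU (hDK ht)))).hasDerivAt) (ih h.2)

/-- Uniform boundedness passes to integrals over a parameter. -/
theorem UnifBdd.integral {X : Type*} [MeasurableSpace X] {μ : Measure X} [IsFiniteMeasure μ]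
    (hD : IsOpen D) {n : ℕ} : ∀ {f : ι → X → ℝ → ℂ},
      (∀ i, ∀ t ∈ D, AEStronglyMeasurable (fun x => f i x t) μ) →
      UnifBdd D n (fun (p : ι × X) => f p.1 p.2) →
      UnifBdd D n (fun i t => ∫ x, f i x t ∂μ) := by
  have key : ∀ {n : ℕ} {f : ι → X → ℝ → ℂ}, UnifBdd D n (fun (p : ι × X) => f p.1 p.2) →
      ∃ C : ℝ, ∀ i, ∀ t ∈ D, ‖∫ x, f i x t ∂μ‖ ≤ C := by
    intro n f h
    obtain ⟨C, -, hC⟩ := h.bound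
    exact ⟨C * μ.real univ, fun i t ht => norm_integral_le_of_norm_le_const
      (Eventually.of_forall fun x => hC (i, x) t ht)⟩
  induction n with
  | zero =>
    intro f hm h
    obtain ⟨C, hC⟩ := key h
    exact ⟨C, by simpa using hC⟩
  | succ n ih =>
    intro f hm h
    obtain ⟨C, hC⟩ := key h
    obtain ⟨C₀, -, hC₀⟩ := h.bound
    obtain ⟨f', hd, h'⟩ := h.exists_deriv
    obtain ⟨C', -, hC'⟩ := h'.bound
    -- The derivative family is only known pointwise, so its measurability in the parameter comes
    -- from its being a limit of difference quotients along a sequence of steps staying in `D`.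
    have hm' : ∀ i, ∀ t ∈ D, AEStronglyMeasurable (fun x => f' (i, x) t) μ := by
      intro i t ht
      obtain ⟨ε, hε, hball⟩ := Metric.isOpen_iff.1 hD t ht
      let u : ℕ → ℝ := fun k => ε / 2 / (k + 1)
      have hu0 : ∀ k, 0 < u k := fun k => by positivity
      have hut : Tendsto u atTop (𝓝 0) := by
        simpa [u, div_eq_mul_inv] using
          (tendsto_one_div_add_atTop_nhds_zero_nat (𝕜 := ℝ)).const_mul (ε / 2)
      have huD : ∀ k, t + u k ∈ D := fun k => hball <| by
        have h1 : u k ≤ ε / 2 := div_le_self (by positivity) (by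
          have : (0 : ℝ) ≤ k := k.cast_nonneg
          linarith)
        simp only [Metric.mem_ball, Real.dist_eq, add_sub_cancel_left, abs_of_pos (hu0 k)]
        linarith
      refine aestronglyMeasurable_of_tendsto_ae atTop
        (f := fun k x => (u k)⁻¹ • (f i x (t + u k) - f i x t))
        (fun k => ((hm i _ (huD k)).sub (hm i t ht)).const_smul (u k)⁻¹)
        (Eventually.of_forall fun x => ?_)
      have := (hasDerivAt_iff_tendsto_slope_zero.1 (hd (i, x) t ht))
      exact this.comp (tendsto_nhdsWithin_iff.2
        ⟨hut, Eventually.of_forall fun k => (hu0 k).ne'⟩)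
    refine UnifBdd.of_deriv hC (f' := fun i t => ∫ x, f' (i, x) t ∂μ) (fun i t ht => ?_)
      (ih (f := fun i x => f' (i, x)) hm' h')
    refine (hasDerivAt_integral_of_dominated_loc_of_deriv_le (F := fun t x => f i x t)
      (F' := fun t x => f' (i, x) t) (bound := fun _ => C') (hD.mem_nhds ht) ?_ ?_ (hm' i t ht)
      (Eventually.of_forall fun x s hs => hC' (i, x) s hs) (integrable_const _)
      (Eventually.of_forall fun x s hs => hd (i, x) s hs)).2
    · filter_upwards [hD.mem_nhds ht] with s hs using hm i s hs
    · exact Integrable.of_bound (hm i t ht) C₀ (Eventually.of_forall fun x => hC₀ (i, x) t ht)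

end Ctrl

theorem one_le_bracket (ξ : Plane) : 1 ≤ bracket ξ := by
  rw [bracket, Real.one_le_sqrt]
  linarith [sq_nonneg ‖ξ‖]

/-! ### Symbol estimates as controlled families on the plane -/

section PlaneCtrl

/-- Uniform control of a family of functions on the plane and of its partial derivatives up to
order `n` by decreasing powers of the bracket. -/
def PlaneCtrl {X : Type*} : ℕ → ℝ → (X → Plane → ℂ) → Prop
  | 0, q, f => ∃ C : ℝ, ∀ x ξ, ‖f x ξ‖ ≤ C * bracket ξ ^ q
  | n + 1, q, f => (∃ C : ℝ, ∀ x ξ, ‖f x ξ‖ ≤ C * bracket ξ ^ q) ∧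
      ∃ f' : Fin 2 → X → Plane → ℂ,
        (∀ x ξ, ∃ L : Plane →L[ℝ] ℂ, HasFDerivAt (f x) L ξ ∧
          ∀ i, L (EuclideanSpace.single i 1) = f' i x ξ) ∧
        ∀ i, PlaneCtrl n (q - 1) (f' i)

theorem PlaneCtrl.bound {X : Type*} {n : ℕ} {q : ℝ} {f : X → Plane → ℂ} (h : PlaneCtrl n q f) :
    ∃ C : ℝ, ∀ x ξ, ‖f x ξ‖ ≤ C * bracket ξ ^ q := by
  cases n with
  | zero => exact h
  | succ n => exact h.1

theorem plane_eq_sum (v : Plane) :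
    v = v 0 • EuclideanSpace.single 0 (1 : ℝ) + v 1 • EuclideanSpace.single 1 (1 : ℝ) := by
  ext i
  fin_cases i <;> simp

/-- Pull-back of a controlled family along a family of curves. -/
theorem PlaneCtrl.comp_curve {X ι : Type*} {D : Set ℝ} {δ : ℝ} {γ γ' : ι → ℝ → Plane}
    (hγ : ∀ i, ∀ t ∈ D, HasDerivAt (γ i) (γ' i t) t) {n : ℕ}
    (hγ' : ∀ k, Ctrl D (fun i t => bracket (γ i t)) δ n (1 + δ) (fun i t => ((γ' i t k : ℝ) : ℂ))) :
    ∀ {q : ℝ} {f : X → Plane → ℂ}, PlaneCtrl n q f →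
      Ctrl D (fun (p : X × ι) t => bracket (γ p.2 t)) δ n q (fun p t => f p.1 (γ p.2 t)) := by
  induction n with
  | zero =>
    intro q f h
    obtain ⟨C, hC⟩ := h.bound
    exact ⟨C, fun p t _ => hC p.1 _⟩
  | succ n ih =>
    intro q f h
    obtain ⟨C, hC⟩ := h.bound
    refine ⟨⟨C, fun p t _ => hC p.1 _⟩, ?_⟩
    obtain ⟨-, f', hd, h'⟩ := h
    -- Chain rule: a ξ-derivative lowers the order by 1 and the velocity of the curve raises it by 1
    -- + δ, so one derivative along the curve costs exactly δ.
    have hmul : ∀ k, Ctrl D (fun (p : X × ι) t => bracket (γ p.2 t)) δ n (q + δ)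
        (fun p t => ((γ' p.2 t k : ℝ) : ℂ) * f' k p.1 (γ p.2 t)) := by
      intro k
      have := ((hγ' k).pred.reindex (Prod.snd : X × ι → ι)).mul (fun p t => one_le_bracket _)
        (ih (fun k => (hγ' k).pred) (h' k))
      rwa [show 1 + δ + (q - 1) = q + δ by ring] at this
    refine ⟨_, fun p t ht => ?_, (hmul 0).add (hmul 1)⟩
    obtain ⟨L, hL, hLe⟩ := hd p.1 (γ p.2 t)
    have := hL.comp_hasDerivAt t (hγ p.2 t ht)
    rw [plane_eq_sum (γ' p.2 t), map_add, map_smul, map_smul, hLe, hLe] at this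
    simpa [Function.comp_def] using this

theorem contDiff_partialXi {g : Plane → Plane → ℂ} (hg : ∀ x, ContDiff ℝ ∞ (g x)) (i : Fin 2)
    (x : Plane) : ContDiff ℝ ∞ (partialXi i g x) :=
  ((hg x).fderiv_right (m := ∞) (by simp)).clm_apply contDiff_const

theorem contDiff_iterate_partialXi {g : Plane → Plane → ℂ} (hg : ∀ x, ContDiff ℝ ∞ (g x))
    (i : Fin 2) (n : ℕ) (x : Plane) : ContDiff ℝ ∞ ((partialXi i)^[n] g x) := by
  induction n generalizing x with
  | zero => exact hg x
  | succ n ih =>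
    rw [Function.iterate_succ_apply']
    exact contDiff_partialXi ih i x

theorem partialXi_comm {g : Plane → Plane → ℂ} (hg : ∀ x, ContDiff ℝ ∞ (g x)) (i j : Fin 2) :
    partialXi i (partialXi j g) = partialXi j (partialXi i g) := by
  funext x ξ
  have h2 : ∀ k l : Fin 2, partialXi k (partialXi l g) x ξ =
      fderiv ℝ (fderiv ℝ (g x)) ξ (EuclideanSpace.single k 1) (EuclideanSpace.single l 1) := by
    intro k l
    have hd : DifferentiableAt ℝ (fderiv ℝ (g x)) ξ :=
      (((hg x).fderiv_right (m := ∞) (by simp)).differentiable (by simp)) ξ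
    have := (hd.hasFDerivAt.clm_apply (hasFDerivAt_const (EuclideanSpace.single l (1 : ℝ)) ξ)).fderiv
    change fderiv ℝ (fun ξ' => fderiv ℝ (g x) ξ' (EuclideanSpace.single l 1)) ξ _ = _
    rw [this]
    simp
  rw [h2, h2]
  exact ((hg x).contDiffAt.isSymmSndFDerivAt
    (by simpa using! (WithTop.coe_le_coe.2 (le_top : (2 : ℕ∞) ≤ ⊤)))).eq _ _

theorem partialXi_iterate_comm {g : Plane → Plane → ℂ} (hg : ∀ x, ContDiff ℝ ∞ (g x))
    (i j : Fin 2) (n : ℕ) :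
    partialXi i ((partialXi j)^[n] g) = (partialXi j)^[n] (partialXi i g) := by
  induction n generalizing g with
  | zero => rfl
  | succ n ih =>
    rw [Function.iterate_succ_apply, Function.iterate_succ_apply,
      ih (contDiff_partialXi hg j), partialXi_comm hg]

theorem contDiff_derivXi {g : Plane → Plane → ℂ} (hg : ∀ x, ContDiff ℝ ∞ (g x)) (α : Fin 2 → ℕ)
    (x : Plane) : ContDiff ℝ ∞ (derivXi α g x) :=
  contDiff_iterate_partialXi (contDiff_iterate_partialXi hg 1 _) 0 _ x

/-- `derivXi` applies its partial derivatives in a fixed order; symmetry of second derivatives moves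
the new one to its place. This makes the family of all ∂_ξ^α closed under differentiation. -/
theorem partialXi_derivXi {g : Plane → Plane → ℂ} (hg : ∀ x, ContDiff ℝ ∞ (g x)) (α : Fin 2 → ℕ)
    (i : Fin 2) : partialXi i (derivXi α g) = derivXi (α + Pi.single i 1) g := by
  fin_cases i
  · simp [derivXi, Function.iterate_succ_apply']
  · simp only [Fin.mk_one, derivXi, Pi.add_apply, Pi.single_eq_same, Function.iterate_succ_apply']
    rw [partialXi_iterate_comm (contDiff_iterate_partialXi hg 1 _)]
    simp

theorem IsSymbol.contDiff_right {m : ℝ} {a : Plane → Plane → ℂ} (ha : IsSymbol m a) (x : Plane) :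
    ContDiff ℝ ∞ (a x) :=
  ha.1.comp (contDiff_const.prodMk contDiff_id)

theorem IsSymbol.contDiff_left {m : ℝ} {a : Plane → Plane → ℂ} (ha : IsSymbol m a) (ξ : Plane) :
    ContDiff ℝ ∞ (fun x => a x ξ) :=
  ha.1.comp (contDiff_id.prodMk contDiff_const)

/-- Stated for all α at once so that the induction closes: the gradient of ∂_ξ^α a consists of the
∂_ξ^{α+e_i} a, one order lower. -/
theorem IsSymbol.planeCtrl_derivXi {m : ℝ} {a : Plane → Plane → ℂ} (ha : IsSymbol m a) (n : ℕ) :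
    ∀ α : Fin 2 → ℕ, PlaneCtrl n (m - ((α 0 + α 1 : ℕ) : ℝ)) (derivXi α a) := by
  induction n with
  | zero => exact fun α => ha.2 α 0
  | succ n ih =>
    intro α
    refine ⟨ha.2 α 0, fun i => derivXi (α + Pi.single i 1) a, fun x ξ => ?_, fun i => ?_⟩
    · refine ⟨_, ((contDiff_derivXi ha.contDiff_right α x).differentiable (by simp)
        ξ).hasFDerivAt, fun i => ?_⟩
      exact congrFun (congrFun (partialXi_derivXi ha.contDiff_right α i) x) ξ
    · have := ih (α + Pi.single i 1)
      convert! this using 1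
      fin_cases i <;> (simp; ring)

theorem IsSymbol.planeCtrl {m : ℝ} {a : Plane → Plane → ℂ} (ha : IsSymbol m a) (n : ℕ) :
    PlaneCtrl n m a := by
  simpa [derivXi] using! ha.planeCtrl_derivXi n 0

end PlaneCtrl

/-! ### Derivatives in the space variable -/

section SpaceDerivatives

theorem contDiff_iterate_partialX {g : Plane → Plane → ℂ}
    (hg : ∀ ξ, ContDiff ℝ ∞ (fun x => g x ξ)) (i : Fin 2) (n : ℕ) (ξ : Plane) :
    ContDiff ℝ ∞ (fun x => (partialX i)^[n] g x ξ) := by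
  induction n generalizing ξ with
  | zero => exact hg ξ
  | succ n ih =>
    simp only [Function.iterate_succ_apply']
    exact ((ih ξ).fderiv_right (m := ∞) (by simp)).clm_apply contDiff_const

theorem IsSymbol.bound_iterate_partialX {m : ℝ} {a : Plane → Plane → ℂ} (ha : IsSymbol m a)
    (i : Fin 2) (k : ℕ) : ∃ C : ℝ, ∀ x ξ, ‖(partialX i)^[k] a x ξ‖ ≤ C * bracket ξ ^ m := by
  obtain ⟨C, hC⟩ := ha.2 0 (Pi.single i k)
  refine ⟨C, fun x ξ => ?_⟩
  have := hC x ξ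
  fin_cases i <;> simpa [derivXi, derivX] using this

/-- Here δ = 0, since x-derivatives do not change the order of a symbol. The base point of the line
and the frequency are parameters of the family, hence uniformity in both. -/
theorem IsSymbol.ctrl_line {m : ℝ} {a : Plane → Plane → ℂ} (ha : IsSymbol m a)
    (i : Fin 2) (n : ℕ) : ∀ k : ℕ, Ctrl univ (fun (p : Plane × Plane) _ => bracket p.2) 0 n m
      (fun p t => (partialX i)^[k] a (p.1 + t • EuclideanSpace.single i 1) p.2) := by
  have key : ∀ k : ℕ, ∃ C : ℝ, ∀ p : Plane × Plane, ∀ t ∈ (univ : Set ℝ),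
      ‖(partialX i)^[k] a (p.1 + t • EuclideanSpace.single i 1) p.2‖ ≤ C * bracket p.2 ^ m := by
    intro k
    obtain ⟨C, hC⟩ := ha.bound_iterate_partialX i k
    exact ⟨C, fun p t _ => hC _ _⟩
  induction n with
  | zero => exact fun k => key k
  | succ n ih =>
    intro k
    refine ⟨key k, fun p t => (partialX i)^[k + 1] a (p.1 + t • EuclideanSpace.single i 1) p.2,
      fun p t _ => ?_, by rw [add_zero]; exact ih (k + 1)⟩
    have h1 : HasDerivAt (fun t : ℝ => p.1 + t • EuclideanSpace.single i (1 : ℝ))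
        (EuclideanSpace.single i (1 : ℝ)) t := by
      simpa using ((hasDerivAt_id t).smul_const (EuclideanSpace.single i (1 : ℝ))).const_add p.1
    have h2 := ((contDiff_iterate_partialX ha.contDiff_left i k p.2).differentiable (by simp)
      (p.1 + t • EuclideanSpace.single i (1 : ℝ))).hasFDerivAt
    have := h2.comp_hasDerivAt t h1
    rw [Function.iterate_succ_apply']
    exact this

end SpaceDerivatives

/-! ### Normalized symbols along lines and circles -/

section Families

/-- The symbol divided by its order of growth. -/
def normalizedSymbol (m : ℝ) (a : Plane → Plane → ℂ) (x ξ : Plane) : ℂ :=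
  ((bracket ξ ^ (-m) : ℝ) : ℂ) * a x ξ

theorem norm_ofReal_bracket_rpow (ξ : Plane) (q : ℝ) :
    ‖((bracket ξ ^ q : ℝ) : ℂ)‖ = bracket ξ ^ q := by
  rw [Complex.norm_real, Real.norm_of_nonneg (Real.rpow_nonneg (bracket_pos ξ).le _)]

theorem IsSymbol.unifBdd_line {m : ℝ} {a : Plane → Plane → ℂ} (ha : IsSymbol m a)
    (i : Fin 2) (n : ℕ) : UnifBdd univ n (fun (p : Plane × Plane) t =>
      normalizedSymbol m a (p.1 + t • EuclideanSpace.single i 1) p.2) := by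
  have h1 := ha.ctrl_line i n 0
  have h2 : Ctrl univ (fun (p : Plane × Plane) _ => bracket p.2) 0 n (-m)
      (fun p _ => ((bracket p.2 ^ (-m) : ℝ) : ℂ)) :=
    Ctrl.const (C := 1) fun p t _ => by rw [norm_ofReal_bracket_rpow, one_mul]
  have h3 := Ctrl.mul (fun p t => one_le_bracket _) h2 h1
  rw [neg_add_cancel] at h3
  exact h3.unifBdd (fun p t => one_le_bracket _) fun j _ => ⟨1, by simp⟩

theorem norm_polarPoint (θ r : ℝ) : ‖polarPoint θ r‖ = |r| := by
  rw [EuclideanSpace.norm_eq, Fin.sum_univ_two]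
  simp only [polarPoint, PiLp.toLp_apply, Matrix.cons_val_zero, Matrix.cons_val_one,
    Real.norm_eq_abs, sq_abs]
  rw [show (r * Real.cos θ) ^ 2 + (r * Real.sin θ) ^ 2 = r ^ 2 by
    rw [mul_pow, mul_pow, ← mul_add, Real.cos_sq_add_sin_sq, mul_one], Real.sqrt_sq_eq_abs]

theorem bracket_polarPoint (θ r : ℝ) : bracket (polarPoint θ r) = √(1 + r ^ 2) := by
  rw [bracket, norm_polarPoint, sq_abs]

theorem abs_le_bracket_polarPoint (θ r : ℝ) : |r| ≤ bracket (polarPoint θ r) := by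
  rw [bracket_polarPoint]
  exact Real.abs_le_sqrt (by linarith)

theorem hasDerivAt_polarPoint {θ r θ' r' : ℝ → ℝ} {t : ℝ} (hθ : HasDerivAt θ (θ' t) t)
    (hr : HasDerivAt r (r' t) t) : HasDerivAt (fun t => polarPoint (θ t) (r t))
      (!₂[r' t * Real.cos (θ t) - r t * (Real.sin (θ t) * θ' t),
        r' t * Real.sin (θ t) + r t * (Real.cos (θ t) * θ' t)] : Plane) t := by
  have h := ((hr.mul hθ.cos).smul_const (EuclideanSpace.single (0 : Fin 2) (1 : ℝ))).add
    ((hr.mul hθ.sin).smul_const (EuclideanSpace.single (1 : Fin 2) (1 : ℝ)))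
  convert! h using 1
  · funext t
    rw [plane_eq_sum (polarPoint (θ t) (r t))]
    rfl
  · ext i
    fin_cases i <;> simp; ring

theorem unifBdd_cos_sin {ι : Type*} (n : ℕ) :
    UnifBdd univ n (fun (_ : ι) t => ((Real.cos t : ℝ) : ℂ)) ∧
      UnifBdd univ n (fun (_ : ι) t => ((Real.sin t : ℝ) : ℂ)) := by
  have hc : ∀ t, ‖((Real.cos t : ℝ) : ℂ)‖ ≤ 1 := fun t => by
    rw [Complex.norm_real]; exact Real.abs_cos_le_one t
  have hs : ∀ t, ‖((Real.sin t : ℝ) : ℂ)‖ ≤ 1 := fun t => by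
    rw [Complex.norm_real]; exact Real.abs_sin_le_one t
  induction n with
  | zero => exact ⟨⟨1, by simpa using fun _ => hc⟩, ⟨1, by simpa using fun _ => hs⟩⟩
  | succ n ih =>
    refine ⟨UnifBdd.of_deriv (fun _ t _ => hc t) (fun _ t _ => (Real.hasDerivAt_cos t).ofReal_comp)
      ?_, UnifBdd.of_deriv (fun _ t _ => hs t)
      (fun _ t _ => (Real.hasDerivAt_sin t).ofReal_comp) ih.1⟩
    have := UnifBdd.mul (UnifBdd.const (C := 1) (c := fun _ : ι => (-1 : ℂ)) (by simp)) ih.2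
    simpa using this

/-- Bounded families are controlled with any weights independent of the variable. -/
theorem UnifBdd.ctrl {ι : Type*} {D : Set ℝ} {w : ι → ℝ → ℝ} {n : ℕ} :
    ∀ {f : ι → ℝ → ℂ}, UnifBdd D n f → Ctrl D w 0 n 0 f := by
  induction n with
  | zero =>
    rintro f ⟨C, hC⟩
    exact ⟨C, by simpa using hC⟩
  | succ n ih =>
    rintro f ⟨⟨C, hC⟩, f', hd, h'⟩
    rw [add_zero] at h'
    refine ⟨⟨C, by simpa using hC⟩, f', hd, ?_⟩
    rw [add_zero]
    exact ih h'

/-- On a circle of radius |r| the velocity is at most ⟨ξ⟩, which compensates the order lost by a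
ξ-derivative: δ = 0. The factor ⟨ξ⟩^{-m} is constant along the circle, so the bounds are uniform in
r. -/
theorem IsSymbol.unifBdd_angle {m : ℝ} {a : Plane → Plane → ℂ} (ha : IsSymbol m a) (n : ℕ) :
    UnifBdd univ n (fun (p : Plane × ℝ) θ => normalizedSymbol m a p.1 (polarPoint θ p.2)) := by
  have hw : ∀ (r θ : ℝ), 1 ≤ bracket (polarPoint θ r) := fun _ _ => one_le_bracket _
  have hr : ∀ {c : ℝ → ℂ}, (∀ r, ‖c r‖ ≤ |r|) →
      Ctrl univ (fun r θ => bracket (polarPoint θ r)) 0 n 1 (fun r _ => c r) := by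
    intro c hc
    refine Ctrl.const (C := 1) fun r θ _ => ?_
    rw [one_mul, Real.rpow_one]
    exact (hc r).trans (abs_le_bracket_polarPoint θ r)
  have hγ : ∀ r : ℝ, ∀ θ ∈ (univ : Set ℝ), HasDerivAt (fun θ => polarPoint θ r)
      (!₂[-(r * Real.sin θ), r * Real.cos θ] : Plane) θ := by
    intro r θ _
    simpa using hasDerivAt_polarPoint (θ := fun t => t) (θ' := fun _ => 1) (r := fun _ => r)
      (r' := fun _ => 0) (hasDerivAt_id θ) (hasDerivAt_const θ r)
  have h1 := PlaneCtrl.comp_curve (n := n) (δ := 0) (γ := fun r θ => polarPoint θ r) hγ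
    (by
      rw [Fin.forall_fin_two]
      constructor
      · have := (hr (c := fun r => -(r : ℂ)) (by simp)).mul hw (unifBdd_cos_sin n).2.ctrl
        simpa using this
      · have := (hr (c := fun r => (r : ℂ)) (by simp)).mul hw (unifBdd_cos_sin n).1.ctrl
        simpa using this) (ha.planeCtrl n)
  have h2 : Ctrl univ (fun (p : Plane × ℝ) θ => bracket (polarPoint θ p.2)) 0 n (-m)
      (fun p θ => ((bracket (polarPoint θ p.2) ^ (-m) : ℝ) : ℂ)) := by
    simp only [bracket_polarPoint]
    refine Ctrl.const (C := 1) fun p t _ => ?_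
    rw [Complex.norm_real, Real.norm_of_nonneg (by positivity), one_mul]
  have h3 := Ctrl.mul (fun p t => one_le_bracket _) h2 h1
  rw [neg_add_cancel] at h3
  exact h3.unifBdd (fun p t => one_le_bracket _) fun j _ => ⟨1, by simp⟩

end Families

/-! ### Smoothness in the compactified radius -/

section Radial

variable {L : ℝ}

theorem algebraicMap_eq {s : ℝ} (hs : s < 1) : algebraicMap L s = 2 * L * (1 - s)⁻¹ - L := by
  have : 1 - s ≠ 0 := by linarith
  rw [algebraicMap]
  field_simp
  ring

theorem hasDerivAt_inv_one_sub {s : ℝ} (hs : s < 1) :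
    HasDerivAt (fun s : ℝ => (1 - s)⁻¹) ((1 - s)⁻¹ * (1 - s)⁻¹) s := by
  have h0 : 1 - s ≠ 0 := by linarith
  convert! ((hasDerivAt_id s).const_sub 1).inv h0 using 1
  simp [sq, neg_neg]

theorem hasDerivAt_algebraicMap {s : ℝ} (hs : s < 1) :
    HasDerivAt (algebraicMap L) (2 * L * ((1 - s)⁻¹ * (1 - s)⁻¹)) s := by
  refine (((hasDerivAt_inv_one_sub hs).const_mul (2 * L)).sub_const L).congr_of_eventuallyEq ?_
  filter_upwards [Iio_mem_nhds hs] with t ht using algebraicMap_eq ht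

/-- The bracket of the frequency reached at the parameter `s` on the ray of angle `θ`. -/
abbrev rayBracket (L θ s : ℝ) : ℝ := bracket (polarPoint θ (algebraicMap L s))

/-- The function u = (1-s)⁻¹ equals (A_L(s) + L)/(2L), so it has order 1, and u' = u² has order 2.
Each derivative thus costs δ = 1, and the estimate at level n gives the one at level n + 1. -/
theorem ctrl_inv_one_sub (hL : 0 < L) (n : ℕ) :
    Ctrl (Iio 1) (rayBracket L) 1 n 1 (fun _ s => (((1 - s)⁻¹ : ℝ) : ℂ)) := by
  have hb : ∀ θ : ℝ, ∀ s ∈ Iio (1 : ℝ), ‖(((1 - s)⁻¹ : ℝ) : ℂ)‖ ≤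
      ((1 + L) / (2 * L)) * rayBracket L θ s ^ (1 : ℝ) := by
    intro θ s hs
    have hs' : 0 < 1 - s := by linarith [mem_Iio.1 hs]
    have h1 : (1 - s)⁻¹ = (algebraicMap L s + L) / (2 * L) := by
      rw [algebraicMap_eq hs]; field_simp; ring
    rw [Complex.norm_real, Real.norm_of_nonneg (by positivity), Real.rpow_one, h1,
      div_mul_eq_mul_div]
    gcongr
    nlinarith [one_le_bracket (polarPoint θ (algebraicMap L s)),
      abs_le_bracket_polarPoint θ (algebraicMap L s), le_abs_self (algebraicMap L s)]
  induction n with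
  | zero => exact ⟨_, hb⟩
  | succ n ih =>
    refine ⟨⟨_, hb⟩, _, fun _ s hs => (hasDerivAt_inv_one_sub hs).ofReal_comp, ?_⟩
    simpa using! ih.mul (fun _ _ => one_le_bracket _) ih

theorem ctrl_const_mul {ι : Type*} {D : Set ℝ} {w : ι → ℝ → ℝ} {δ q : ℝ} {n : ℕ}
    {f : ι → ℝ → ℂ} (hw : ∀ i t, 1 ≤ w i t) {c : ι → ℂ} {C : ℝ} (hc : ∀ i, ‖c i‖ ≤ C)
    (hf : Ctrl D w δ n q f) : Ctrl D w δ n q (fun i t => c i * f i t) := by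
  have := Ctrl.mul hw (Ctrl.const (q := 0) (C := C) fun i t _ => by simpa using hc i) hf
  rwa [zero_add] at this

theorem ctrl_deriv_algebraicMap (hL : 0 < L) (n : ℕ) :
    Ctrl (Iio 1) (rayBracket L) 1 n 2
      (fun _ s => ((2 * L * ((1 - s)⁻¹ * (1 - s)⁻¹) : ℝ) : ℂ)) := by
  have h := (ctrl_inv_one_sub hL n).mul (fun _ _ => one_le_bracket _) (ctrl_inv_one_sub hL n)
  rw [show (1 : ℝ) + 1 = 2 by norm_num] at h
  simpa using! ctrl_const_mul (fun _ _ => one_le_bracket _) (c := fun _ => ((2 * L : ℝ) : ℂ))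
    (fun _ => le_rfl) h

theorem ctrl_algebraicMap (hL : 0 < L) (n : ℕ) :
    Ctrl (Iio 1) (rayBracket L) 1 n 1 (fun _ s => ((algebraicMap L s : ℝ) : ℂ)) := by
  have hb : ∀ θ : ℝ, ∀ s ∈ Iio (1 : ℝ), ‖((algebraicMap L s : ℝ) : ℂ)‖ ≤
      1 * rayBracket L θ s ^ (1 : ℝ) := fun θ s _ => by
    rw [Complex.norm_real, Real.rpow_one, one_mul]
    exact abs_le_bracket_polarPoint _ _
  cases n with
  | zero => exact ⟨_, hb⟩
  | succ n =>
    refine ⟨⟨_, hb⟩, _, fun _ s hs => (hasDerivAt_algebraicMap hs).ofReal_comp, ?_⟩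
    rw [show (1 : ℝ) + 1 = 2 by norm_num]
    exact ctrl_deriv_algebraicMap hL n

/-- The s-derivative of ⟨ξ⟩^q is q A_L A_L' ⟨ξ⟩^{q-2}, of order 1 + 2 + (q - 2) = q + 1. The
exponent varies in the induction because q - 2 appears. -/
theorem ctrl_rayBracket_rpow (hL : 0 < L) (n : ℕ) : ∀ q : ℝ,
    Ctrl (Iio 1) (rayBracket L) 1 n q (fun θ s => ((rayBracket L θ s ^ q : ℝ) : ℂ)) := by
  have hb : ∀ q θ : ℝ, ∀ s ∈ Iio (1 : ℝ), ‖((rayBracket L θ s ^ q : ℝ) : ℂ)‖ ≤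
      1 * rayBracket L θ s ^ q := fun q θ s _ => by
    rw [norm_ofReal_bracket_rpow, one_mul]
  have heq : ∀ q θ s : ℝ, rayBracket L θ s ^ q = (1 + algebraicMap L s ^ 2) ^ (q / 2) := by
    intro q θ s
    rw [rayBracket, bracket_polarPoint, Real.sqrt_eq_rpow, ← Real.rpow_mul (by positivity)]
    congr 1; ring
  induction n with
  | zero => exact fun q => ⟨_, hb q⟩
  | succ n ih =>
    intro q
    refine ⟨⟨_, hb q⟩, fun θ s => (q : ℂ) * (((algebraicMap L s : ℝ) : ℂ) *
      (((2 * L * ((1 - s)⁻¹ * (1 - s)⁻¹) : ℝ) : ℂ) * ((rayBracket L θ s ^ (q - 2) : ℝ) : ℂ))),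
      fun θ s hs => ?_, ?_⟩
    · have h1 := (((hasDerivAt_algebraicMap (L := L) hs).pow 2).const_add 1).rpow_const (p := q / 2)
        (Or.inl (by simp only [Pi.pow_apply]; positivity))
      have h2 := h1.ofReal_comp
      simp only [heq]
      convert! h2 using 1
      simp only [Pi.pow_apply, ← Complex.ofReal_mul]
      norm_cast
      rw [show (q - 2) / 2 = q / 2 - 1 by ring]
      simp
      ring
    · have h := (ctrl_algebraicMap hL n).mul (fun _ _ => one_le_bracket _)
        ((ctrl_deriv_algebraicMap hL n).mul (fun _ _ => one_le_bracket _) (ih (q - 2)))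
      rw [show 1 + (2 + (q - 2)) = q + 1 by ring] at h
      exact ctrl_const_mul (fun _ _ => one_le_bracket _) (fun _ => le_rfl) h

/-- A symbol along the rays, divided by its order of growth. -/
theorem IsSymbol.ctrl_ray (hL : 0 < L) {m q : ℝ} {a : Plane → Plane → ℂ} (ha : IsSymbol q a)
    (n : ℕ) : Ctrl (Iio 1) (fun (p : Plane × ℝ) s => rayBracket L p.2 s) 1 n (-m + q)
      (fun p s => normalizedSymbol m a p.1 (polarPoint p.2 (algebraicMap L s))) := by
  have hγ : ∀ θ : ℝ, ∀ s ∈ Iio (1 : ℝ), HasDerivAt (fun s => polarPoint θ (algebraicMap L s))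
      (!₂[2 * L * ((1 - s)⁻¹ * (1 - s)⁻¹) * Real.cos θ,
        2 * L * ((1 - s)⁻¹ * (1 - s)⁻¹) * Real.sin θ] : Plane) s := by
    intro θ s hs
    simpa using hasDerivAt_polarPoint (θ := fun _ => θ) (θ' := fun _ => 0) (r := algebraicMap L)
      (r' := fun s => 2 * L * ((1 - s)⁻¹ * (1 - s)⁻¹)) (hasDerivAt_const s θ)
      (hasDerivAt_algebraicMap hs)
  have h1 := PlaneCtrl.comp_curve (n := n) (δ := 1)
    (γ := fun θ s => polarPoint θ (algebraicMap L s)) hγ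
    (by
      rw [Fin.forall_fin_two, show (1 : ℝ) + 1 = 2 by norm_num]
      constructor
      · have := ctrl_const_mul (fun _ _ => one_le_bracket _) (c := fun θ => ((Real.cos θ : ℝ) : ℂ))
          (C := 1) (fun θ => by rw [Complex.norm_real]; exact Real.abs_cos_le_one θ)
          (ctrl_deriv_algebraicMap hL n)
        simpa [mul_comm] using! this
      · have := ctrl_const_mul (fun _ _ => one_le_bracket _) (c := fun θ => ((Real.sin θ : ℝ) : ℂ))
          (C := 1) (fun θ => by rw [Complex.norm_real]; exact Real.abs_sin_le_one θ)
          (ctrl_deriv_algebraicMap hL n)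
        simpa [mul_comm] using! this) (ha.planeCtrl n)
  exact ((ctrl_rayBracket_rpow hL n (-m)).reindex (Prod.snd : Plane × ℝ → ℝ)).mul
    (fun _ _ => one_le_bracket _) h1

theorem polarArg_polarPoint {θ r : ℝ} (hr : 0 < r) :
    polarArg (polarPoint θ r) = polarArg (polarPoint θ 1) := by
  rw [polarArg, polarArg, ← Complex.arg_real_mul ⟨polarPoint θ 1 0, polarPoint θ 1 1⟩ hr]
  congr 1
  apply Complex.ext <;> simp [polarPoint]

/-- The radial factor of a normalized homogeneous term, in terms of the inverse radius. -/
theorem bracket_rpow_mul_rpow {m j r : ℝ} (hr : 0 < r) (θ : ℝ) :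
    bracket (polarPoint θ r) ^ (-m) * r ^ (m - j) = (1 + r⁻¹ ^ 2) ^ (-m / 2) * r⁻¹ ^ j := by
  rw [bracket_polarPoint, Real.sqrt_eq_rpow, ← Real.rpow_mul (by positivity),
    show 1 + r⁻¹ ^ 2 = (1 + r ^ 2) / r ^ 2 by field_simp; ring,
    Real.div_rpow (by positivity) (by positivity), ← Real.rpow_natCast r 2, ← Real.rpow_mul hr.le,
    Real.inv_rpow hr.le, Real.rpow_sub hr]
  have : r ^ (((2 : ℕ) : ℝ) * (-m / 2)) = (r ^ m)⁻¹ := by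
    rw [← Real.rpow_neg hr.le]; congr 1; push_cast; ring
  rw [this, show 1 / 2 * -m = -m / 2 by ring]
  field_simp

/-- The expansion at infinity enters here. To control n derivatives, n homogeneous terms are split
off: the normalized remainder has order -n, so its j-th derivative has order j - n ≤ 0. In the terms
themselves s occurs only in a radial factor smooth at s = 1, so for b_j a sup bound suffices. -/
theorem IsClassicalSymbol.unifBdd_ray_near (hL : 0 < L) {m : ℝ} {a : Plane → Plane → ℂ}
    {b : ℕ → Plane → ℝ → ℂ} (ha : IsClassicalSymbol m a b) (hb : TemperedGrowth b) (n : ℕ) :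
    UnifBdd (Ioo ((2 - L) / (2 + L)) 1) n (fun (p : Plane × ℝ) s =>
      normalizedSymbol m a p.1 (polarPoint p.2 (algebraicMap L s))) := by
  -- The parameter of radius 2, beyond which the cutoff equals 1.
  set s₀ := (2 - L) / (2 + L) with hs₀
  have hs₀' : -1 < s₀ := by rw [hs₀, lt_div_iff₀ (by linarith)]; linarith
  have hr : ∀ s ∈ Ioo s₀ 1, 2 < algebraicMap L s := by
    rintro s ⟨h1, h2⟩
    rw [hs₀, div_lt_iff₀ (by linarith)] at h1
    rw [algebraicMap, lt_div_iff₀ (by linarith)]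
    linarith
  obtain ⟨Q, R, hR, hQ⟩ := hb
  have hrem : UnifBdd (Ioo s₀ 1) n (fun (p : Plane × ℝ) s => normalizedSymbol m
      (fun x ξ => a x ξ - ∑ j ∈ Finset.range n, homogeneousTerm m j (b j) x ξ) p.1
      (polarPoint p.2 (algebraicMap L s))) := by
    refine (((ha.expansion n).ctrl_ray hL (m := m) n).mono_set fun s hs => hs.2).unifBdd
      (fun _ _ => one_le_bracket _) fun j hj => ⟨1, fun p s _ => ?_⟩
    refine Real.rpow_le_one_of_one_le_of_nonpos (one_le_bracket _) ?_
    have : (j : ℝ) ≤ n := by exact_mod_cast hj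
    linarith
  have hterm : ∀ j : ℕ, UnifBdd (Ioo s₀ 1) n (fun (p : Plane × ℝ) s =>
      b j p.1 (polarArg (polarPoint p.2 1)) *
        (((1 + (algebraicMap L s)⁻¹ ^ 2) ^ (-m / 2) * (algebraicMap L s)⁻¹ ^ (j : ℝ) : ℝ) : ℂ)) := by
    intro j
    refine UnifBdd.mul (UnifBdd.const (C := Q 0 0 * R ^ j) fun p => hQ 0 0 j _ _) ?_
    -- In terms of 1/r = (1-s)/(L(1+s)) the radial factor is smooth on a neighbourhood of the
    -- compact interval up to and including s = 1.
    refine unifBdd_of_contDiffOn (U := Ioi (-1)) (K := Icc s₀ 1) isOpen_Ioi isCompact_Icc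
      (fun s hs => hs₀'.trans_le hs.1) Ioo_subset_Icc_self ?_
    have hinv : ∀ s : ℝ, (algebraicMap L s)⁻¹ = (1 - s) / (L * (1 + s)) := fun s => by
      rw [algebraicMap, inv_div]
    simp only [hinv, Real.rpow_natCast]
    have h1 : ContDiffOn ℝ ∞ (fun s : ℝ => (1 - s) / (L * (1 + s))) (Ioi (-1)) := by
      refine ContDiffOn.div (by fun_prop) (by fun_prop) fun s hs => ?_
      have : 0 < 1 + s := by linarith [mem_Ioi.1 hs]
      positivity
    refine Complex.ofRealCLM.contDiff.comp_contDiffOn (ContDiffOn.mul ?_ (h1.pow j))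
    exact (contDiffOn_const.add (h1.pow 2)).rpow_const_of_ne fun s _ => by positivity
  refine (hrem.add (Ctrl.sum (Finset.range n) fun j _ => hterm j)).congr isOpen_Ioo ?_
  rintro p s hs
  have hr2 := hr s hs
  have hr0 : 0 < algebraicMap L s := by linarith
  have hhom : ∀ j : ℕ, normalizedSymbol m (homogeneousTerm m j (b j)) p.1
      (polarPoint p.2 (algebraicMap L s)) = b j p.1 (polarArg (polarPoint p.2 1)) *
        (((1 + (algebraicMap L s)⁻¹ ^ 2) ^ (-m / 2) * (algebraicMap L s)⁻¹ ^ (j : ℝ) : ℝ) : ℂ) := by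
    intro j
    rw [← bracket_rpow_mul_rpow hr0 p.2, normalizedSymbol, homogeneousTerm, norm_polarPoint,
      abs_of_pos hr0, polarArg_polarPoint hr0, radialCutoff,
      Real.smoothTransition.one_of_one_le (by linarith)]
    push_cast
    ring
  simp only [← hhom, normalizedSymbol]
  rw [← Finset.mul_sum]
  ring

theorem IsClassicalSymbol.isSymbol {m : ℝ} {a : Plane → Plane → ℂ}
    {b : ℕ → Plane → ℝ → ℂ} (ha : IsClassicalSymbol m a b) : IsSymbol m a := by
  simpa using ha.expansion 0

/-- The normalized symbol is smooth up to infinite frequency, in the variable of the algebraic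
map. -/
theorem IsClassicalSymbol.unifBdd_ray (hL : 0 < L) {m : ℝ} {a : Plane → Plane → ℂ}
    {b : ℕ → Plane → ℝ → ℂ} (ha : IsClassicalSymbol m a b) (hb : TemperedGrowth b) (n : ℕ) :
    UnifBdd (Iio 1) n (fun (p : Plane × ℝ) s =>
      normalizedSymbol m a p.1 (polarPoint p.2 (algebraicMap L s))) := by
  -- The parameter of radius 3, chosen beyond 2 so that the two open pieces overlap. For s < s₁ the
  -- map A_L takes values between -L and 3, negative ones included, so the bracket is bounded and
  -- the loss of powers is harmless.
  set s₁ := (3 - L) / (3 + L) with hs₁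
  have hs₁' : s₁ < 1 := by rw [hs₁, div_lt_one (by linarith)]; linarith
  have h01 : (2 - L) / (2 + L) < s₁ := by
    rw [hs₁, div_lt_div_iff₀ (by linarith) (by linarith)]; nlinarith
  have hfar : UnifBdd (Iio s₁) n (fun (p : Plane × ℝ) s =>
      normalizedSymbol m a p.1 (polarPoint p.2 (algebraicMap L s))) := by
    refine ((ha.isSymbol.ctrl_ray hL (m := m) n).mono_set
      fun s hs => (mem_Iio.1 hs).trans hs₁').unifBdd (fun _ _ => one_le_bracket _)
      fun j hj => ⟨(√(1 + (3 + L) ^ 2)) ^ j, fun p s hs => ?_⟩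
    rw [neg_add_cancel, zero_add, mul_one, Real.rpow_natCast]
    refine pow_le_pow_left₀ (bracket_pos _).le ?_ j
    rw [bracket_polarPoint]
    refine Real.sqrt_le_sqrt (add_le_add_right (sq_le_sq' ?_ ?_) 1)
    · have : 0 ≤ (1 - s)⁻¹ := inv_nonneg.2 (by linarith [mem_Iio.1 hs])
      rw [algebraicMap_eq ((mem_Iio.1 hs).trans hs₁')]
      nlinarith
    · have h1 : s < s₁ := hs
      rw [hs₁, lt_div_iff₀ (by linarith)] at h1
      rw [algebraicMap, div_le_iff₀ (by linarith [mem_Iio.1 hs])]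
      nlinarith [mem_Iio.1 hs]
  have := (ha.unifBdd_ray_near hL hb n).union isOpen_Ioo isOpen_Iio hfar
  refine this.mono_set fun s hs => ?_
  rcases lt_or_ge s s₁ with h | h
  · exact Or.inr h
  · exact Or.inl ⟨h01.trans_le h, hs⟩

end Radial

/-! ### Fourier coefficients and series in one variable -/

section FourierDecay

theorem UnifBdd.continuousOn {ι : Type*} {D : Set ℝ} {n : ℕ} {f : ι → ℝ → ℂ}
    (h : UnifBdd D (n + 1) f) (i : ι) : ContinuousOn (f i) D := by
  obtain ⟨f', hd, -⟩ := h.exists_deriv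
  exact fun t ht => (hd i t ht).continuousAt.continuousWithinAt

/-- The exponential of frequency `k`, with base pulsation `w`. -/
abbrev circleExp (w : ℝ) (k : ℤ) (t : ℝ) : ℂ := Complex.exp (Complex.I * (k : ℂ) * (w * t : ℝ))

theorem norm_circleExp (w : ℝ) (k : ℤ) (t : ℝ) : ‖circleExp w k t‖ = 1 := by
  rw [circleExp, show Complex.I * (k : ℂ) * ((w * t : ℝ) : ℂ) = ((k * (w * t) : ℝ) : ℂ) * Complex.I by
    push_cast; ring]
  exact Complex.norm_exp_ofReal_mul_I _

theorem continuous_circleExp (w : ℝ) (k : ℤ) : Continuous (circleExp w k) := by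
  unfold circleExp; fun_prop

theorem hasDerivAt_circleExp (w : ℝ) (k : ℤ) (t : ℝ) :
    HasDerivAt (circleExp w k) (Complex.I * k * w * circleExp w k t) t := by
  have h := ((((hasDerivAt_id t).const_mul w).ofReal_comp).const_mul (Complex.I * (k : ℂ))).cexp
  convert! h using 1
  simp [circleExp]
  ring

theorem circleExp_periodic {w T : ℝ} (hwT : w * T = 2 * Real.pi) (k : ℤ) :
    Function.Periodic (circleExp w k) T := by
  intro t
  rw [circleExp, circleExp, mul_add, hwT,
    show Complex.I * (k : ℂ) * ((w * t + 2 * Real.pi : ℝ) : ℂ) =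
      Complex.I * (k : ℂ) * ((w * t : ℝ) : ℂ) + k * (2 * Real.pi * Complex.I) by push_cast; ring]
  exact Complex.exp_periodic.int_mul k _

theorem integral_deriv_mul_circleExp {w T : ℝ} (hwT : w * T = 2 * Real.pi)
    {f f' : ℝ → ℂ} (hd : ∀ t, HasDerivAt f (f' t) t) (hf' : Continuous f')
    (hper : Function.Periodic f T) (k : ℤ) :
    ∫ t in (0 : ℝ)..T, f' t * circleExp w (-k) t =
      Complex.I * k * w * ∫ t in (0 : ℝ)..T, f t * circleExp w (-k) t := by
  have hf : Continuous f := continuous_iff_continuousAt.2 fun t => (hd t).continuousAt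
  have hc := continuous_circleExp w (-k)
  have h := intervalIntegral.integral_eq_sub_of_hasDerivAt (a := 0) (b := T)
    (fun t _ => (hd t).mul (hasDerivAt_circleExp w (-k) t))
    ((by fun_prop : Continuous fun t => f' t * circleExp w (-k) t +
      f t * (Complex.I * ((-k : ℤ) : ℂ) * w * circleExp w (-k) t)).intervalIntegrable 0 T)
  have h0 : f T * circleExp w (-k) T = f 0 * circleExp w (-k) 0 := by
    have h1 := hper 0
    have h2 := circleExp_periodic hwT (-k) 0
    rw [zero_add] at h1 h2
    rw [h1, h2]
  simp only [Pi.mul_apply] at h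
  rw [h0, sub_self, intervalIntegral.integral_add
    ((by fun_prop : Continuous fun t => f' t * circleExp w (-k) t).intervalIntegrable 0 T)
    ((by fun_prop : Continuous fun t =>
      f t * (Complex.I * ((-k : ℤ) : ℂ) * w * circleExp w (-k) t)).intervalIntegrable 0 T)] at h
  rw [eq_neg_of_add_eq_zero_left h, ← intervalIntegral.integral_const_mul,
    ← intervalIntegral.integral_neg]
  congr 1
  funext t
  push_cast
  ring

/-- Repeated integration by parts, with boundary terms cancelled by periodicity. The one derivative
in excess of n provides the continuity of the last derivative integrated. -/
theorem UnifBdd.exists_fourier_decay {ι : Type*} {w T : ℝ} (hw : 0 < w)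
    (hwT : w * T = 2 * Real.pi) (n : ℕ) : ∀ {f : ι → ℝ → ℂ}, UnifBdd univ (n + 1) f →
      (∀ i, Function.Periodic (f i) T) →
      ∃ C : ℝ, ∀ i (k : ℤ), |(k : ℝ)| ^ n * ‖∫ t in (0 : ℝ)..T, f i t * circleExp w (-k) t‖ ≤ C := by
  induction n with
  | zero =>
    intro f hf _
    obtain ⟨C, hC0, hC⟩ := hf.bound
    refine ⟨C * |T - 0|, fun i k => ?_⟩
    rw [pow_zero, one_mul]
    refine intervalIntegral.norm_integral_le_of_norm_le_const fun t _ => ?_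
    rw [norm_mul, norm_circleExp, mul_one]
    exact hC i t (mem_univ t)
  | succ n ih =>
    intro f hf hper
    obtain ⟨f', hd, hf'⟩ := hf.exists_deriv
    have hper' : ∀ i, Function.Periodic (f' i) T := by
      intro i t
      have h1 := (hd i (t + T) (mem_univ _)).comp_add_const t T
      simp only [hper i _] at h1
      exact h1.unique (hd i t (mem_univ t))
    obtain ⟨C, hC⟩ := ih hf' hper'
    refine ⟨w⁻¹ * C, fun i k => ?_⟩
    have h := hC i k
    rw [integral_deriv_mul_circleExp hwT (fun t => hd i t (mem_univ t))
      (continuousOn_univ.1 (hf'.continuousOn i)) (hper i)] at h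
    simp only [norm_mul, Complex.norm_I, Complex.norm_intCast, Complex.norm_real, one_mul,
      Real.norm_of_nonneg hw.le] at h
    rw [le_inv_mul_iff₀ hw]
    refine le_trans (le_of_eq ?_) h
    ring

/-- Fourier inversion for continuous periodic functions with summable coefficients. -/
theorem hasSum_circleExp {w T : ℝ} (hT : 0 < T) (hwT : w * T = 2 * Real.pi) {f : ℝ → ℂ}
    (hf : Continuous f) (hper : Function.Periodic f T)
    (hs : Summable fun k : ℤ => (1 / T : ℂ) * ∫ t in (0 : ℝ)..T, f t * circleExp w (-k) t) (t : ℝ) :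
    HasSum (fun k : ℤ => ((1 / T : ℂ) * ∫ t in (0 : ℝ)..T, f t * circleExp w (-k) t) *
      circleExp w k t) (f t) := by
  have hfact := Fact.mk hT
  have hcont : Continuous hper.lift := by
    rw [(QuotientAddGroup.isQuotientMap_mk _).continuous_iff]
    exact hf
  let F : C(AddCircle T, ℂ) := ⟨hper.lift, hcont⟩
  have hexp : ∀ (k : ℤ) (t : ℝ), fourier k (t : AddCircle T) = circleExp w k t := by
    intro k t
    rw [fourier_coe_apply, circleExp]
    congr 1
    have : (T : ℂ) ≠ 0 := by exact_mod_cast hT.ne'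
    have h2 : (w : ℂ) * T = 2 * Real.pi := by exact_mod_cast hwT
    field_simp
    push_cast
    linear_combination (-(k : ℂ) * t) * h2
  have hcoef : ∀ k : ℤ, fourierCoeff F k =
      (1 / T : ℂ) * ∫ t in (0 : ℝ)..T, f t * circleExp w (-k) t := by
    intro k
    rw [fourierCoeff_eq_intervalIntegral _ _ 0, zero_add, Complex.real_smul]
    push_cast
    congr 1
    refine intervalIntegral.integral_congr fun t _ => ?_
    simp only [hexp, smul_eq_mul]
    rw [mul_comm]
    rfl
  have := has_pointwise_sum_fourier_series_of_summable (f := F)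
    (by simpa only [funext hcoef] using hs) (t : AddCircle T)
  simp only [hcoef, hexp, smul_eq_mul] at this
  exact this

end FourierDecay

/-! ### Chebyshev coefficients and series -/

section Chebyshev

theorem chebT_cos (n : ℕ) (φ : ℝ) : chebT n (Real.cos φ) = Real.cos (n * φ) := by
  rw [chebT, Polynomial.Chebyshev.T_real_cos]
  simp

theorem abs_chebT_le_one (n : ℕ) {s : ℝ} (hs : |s| ≤ 1) : |chebT n s| ≤ 1 :=
  Polynomial.Chebyshev.abs_eval_T_real_le_one _ hs

/-- Substitution φ = arccos s, which absorbs the singular weight. The map is monotone, so no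
regularity of `G` is needed. -/
theorem integral_chebyshev_eq (G : ℝ → ℂ) (n : ℕ) :
    ∫ s in (-1 : ℝ)..1, G s * ((chebT n s / √(1 - s ^ 2) : ℝ) : ℂ) =
      ∫ φ in (0 : ℝ)..Real.pi, G (Real.cos φ) * ((Real.cos (n * φ) : ℝ) : ℂ) := by
  have h := intervalIntegral.integral_deriv_smul_comp_of_deriv_nonpos (a := 1) (b := -1)
    (f := Real.arccos) (f' := fun s => -(1 / √(1 - s ^ 2)))
    (g := fun φ => G (Real.cos φ) * ((Real.cos (n * φ) : ℝ) : ℂ))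
    Real.continuous_arccos.continuousOn
    (fun x hx => Real.hasDerivAt_arccos (by rintro rfl; simp at hx) (by rintro rfl; simp at hx))
    (fun x _ => by simp)
  rw [Real.arccos_one, Real.arccos_neg_one] at h
  rw [← h, intervalIntegral.integral_symm, ← intervalIntegral.integral_neg]
  refine intervalIntegral.integral_congr fun s hs => ?_
  rw [uIcc_of_ge (by norm_num)] at hs
  have h2 : chebT n s = Real.cos (n * Real.arccos s) := by
    rw [← chebT_cos, Real.cos_arccos hs.1 hs.2]
  simp only [Function.comp_apply, Real.cos_arccos hs.1 hs.2, ← h2, Complex.real_smul]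
  push_cast
  ring

/-- The interval is asymmetric on purpose: s = 1 is infinite frequency, where no value is available,
while s = -1 is the origin and is interior. The bound -2 is only a convenient number below -1. -/
theorem cos_mem_Ioo {φ : ℝ} (h : φ ∈ Ioc 0 Real.pi) : Real.cos φ ∈ Ioo (-2 : ℝ) 1 := by
  have := Real.strictAntiOn_cos ⟨le_rfl, Real.pi_pos.le⟩ ⟨h.1.le, h.2⟩ h.1
  rw [Real.cos_zero] at this
  exact ⟨by linarith [Real.neg_one_le_cos φ], this⟩

theorem UnifBdd.intervalIntegrable_comp_cos {ι : Type*} {n : ℕ} {u : ι → ℝ → ℂ}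
    (hu : UnifBdd (Ioo (-2) 1) (n + 1) u) (i : ι) {g : ℝ → ℂ} (hg : Continuous g) :
    IntervalIntegrable (fun φ => u i (Real.cos φ) * g φ) volume 0 Real.pi := by
  have h1 : IntervalIntegrable (fun φ => u i (Real.cos φ)) volume 0 Real.pi := by
    obtain ⟨C, -, hC⟩ := hu.bound
    rw [intervalIntegrable_iff_integrableOn_Ioc_of_le Real.pi_pos.le]
    refine Integrable.of_bound (C := C) ?_ ?_
    · exact ((hu.continuousOn i).comp Real.continuous_cos.continuousOn
        fun φ hφ => cos_mem_Ioo hφ).aestronglyMeasurable measurableSet_Ioc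
    · filter_upwards [ae_restrict_mem measurableSet_Ioc] with φ hφ
        using hC i _ (cos_mem_Ioo hφ)
  exact h1.mul_continuousOn hg.continuousOn

/-- Integration by parts against the Sturm-Liouville operator of the Chebyshev polynomials. -/
theorem sq_mul_integral_comp_cos {u u' u'' : ℝ → ℂ} {C C' : ℝ}
    (hd : ∀ s ∈ Ioo (-2 : ℝ) 1, HasDerivAt u (u' s) s) (hd' : ∀ s ∈ Ioo (-2 : ℝ) 1, HasDerivAt u' (u'' s) s)
    (hC : ∀ s ∈ Ioo (-2 : ℝ) 1, ‖u s‖ ≤ C) (hC' : ∀ s ∈ Ioo (-2 : ℝ) 1, ‖u' s‖ ≤ C') (n : ℕ)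
    (hi : IntervalIntegrable (fun φ => u (Real.cos φ) * ((Real.cos (n * φ) : ℝ) : ℂ))
      volume 0 Real.pi)
    (hi' : IntervalIntegrable (fun φ => ((Real.cos φ : ℂ) * u' (Real.cos φ) +
      ((Real.cos φ : ℂ) ^ 2 - 1) * u'' (Real.cos φ)) * ((Real.cos (n * φ) : ℝ) : ℂ))
      volume 0 Real.pi) :
    (n : ℂ) ^ 2 * ∫ φ in (0 : ℝ)..Real.pi, u (Real.cos φ) * ((Real.cos (n * φ) : ℝ) : ℂ) =
      ∫ φ in (0 : ℝ)..Real.pi, ((Real.cos φ : ℂ) * u' (Real.cos φ) +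
        ((Real.cos φ : ℂ) ^ 2 - 1) * u'' (Real.cos φ)) * ((Real.cos (n * φ) : ℝ) : ℂ) := by
  -- The Wronskian-type primitive of the difference of the two integrands; with s = cos φ, the
  -- operator -d²/dφ² reads s u' + (s² - 1) u''. Each term carries sin(nφ) or sin φ, so `P` tends to
  -- 0 at both ends as soon as u and u' are bounded.
  let P : ℝ → ℂ := fun φ => (n : ℂ) * (u (Real.cos φ) * ((Real.sin (n * φ) : ℝ) : ℂ)) -
    u' (Real.cos φ) * ((Real.sin φ * Real.cos (n * φ) : ℝ) : ℂ)
  have hlt : ∀ φ ∈ Ioo 0 Real.pi, Real.cos φ ∈ Ioo (-2 : ℝ) 1 :=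
    fun φ hφ => cos_mem_Ioo ⟨hφ.1, hφ.2.le⟩
  have hder : ∀ φ ∈ Ioo 0 Real.pi, HasDerivAt P
      ((n : ℂ) ^ 2 * (u (Real.cos φ) * ((Real.cos (n * φ) : ℝ) : ℂ)) -
        ((Real.cos φ : ℂ) * u' (Real.cos φ) + ((Real.cos φ : ℂ) ^ 2 - 1) * u'' (Real.cos φ)) *
          ((Real.cos (n * φ) : ℝ) : ℂ)) φ := by
    intro φ hφ
    have h1 : HasDerivAt (fun φ => u (Real.cos φ)) ((-Real.sin φ) • u' (Real.cos φ)) φ :=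
      (hd _ (hlt φ hφ)).scomp φ (Real.hasDerivAt_cos φ)
    have h2 : HasDerivAt (fun φ => u' (Real.cos φ)) ((-Real.sin φ) • u'' (Real.cos φ)) φ :=
      (hd' _ (hlt φ hφ)).scomp φ (Real.hasDerivAt_cos φ)
    have hn : HasDerivAt (fun φ : ℝ => (n : ℝ) * φ) n φ := by
      simpa using (hasDerivAt_id φ).const_mul (n : ℝ)
    have h3 := ((h1.mul hn.sin.ofReal_comp).const_mul (n : ℂ)).sub
      (h2.mul (((Real.hasDerivAt_sin φ).mul hn.cos).ofReal_comp))
    refine h3.congr_deriv ?_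
    have hsq : ((Real.sin φ : ℝ) : ℂ) ^ 2 = 1 - ((Real.cos φ : ℝ) : ℂ) ^ 2 := by
      exact_mod_cast Real.sin_sq φ
    simp only [Complex.real_smul, Pi.mul_apply]
    push_cast at hsq ⊢
    linear_combination (Complex.cos (n * φ) * u'' (Real.cos φ)) * hsq
  have hlim : ∀ (l : Filter ℝ) (c : ℝ), l ≤ 𝓝 c → (∀ᶠ φ in l, φ ∈ Ioo 0 Real.pi) →
      Real.sin c = 0 → Real.sin (n * c) = 0 → Tendsto P l (𝓝 0) := by
    intro l c hl hev h1 h2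
    have t1 : Tendsto (fun φ : ℝ => ((Real.sin (n * φ) : ℝ) : ℂ)) l (𝓝 0) := by
      have : Continuous fun φ : ℝ => ((Real.sin (n * φ) : ℝ) : ℂ) := by fun_prop
      have h := (this.tendsto c).mono_left hl
      rwa [h2, Complex.ofReal_zero] at h
    have t2 : Tendsto (fun φ : ℝ => ((Real.sin φ * Real.cos (n * φ) : ℝ) : ℂ)) l (𝓝 0) := by
      have : Continuous fun φ : ℝ => ((Real.sin φ * Real.cos (n * φ) : ℝ) : ℂ) := by fun_prop
      have h := (this.tendsto c).mono_left hl
      rwa [h1, zero_mul, Complex.ofReal_zero] at h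
    have b1 : IsBoundedUnder (· ≤ ·) l fun φ => ‖u (Real.cos φ)‖ :=
      ⟨C, eventually_map.2 (hev.mono fun φ hφ => hC _ (hlt φ hφ))⟩
    have b2 : IsBoundedUnder (· ≤ ·) l fun φ => ‖u' (Real.cos φ)‖ :=
      ⟨C', eventually_map.2 (hev.mono fun φ hφ => hC' _ (hlt φ hφ))⟩
    have h3 := ((isBoundedUnder_le_mul_tendsto_zero b1 t1).const_mul (n : ℂ)).sub (isBoundedUnder_le_mul_tendsto_zero b2 t2)
    rwa [mul_zero, sub_zero] at h3
  have hev0 : ∀ᶠ φ in 𝓝[>] (0 : ℝ), φ ∈ Ioo 0 Real.pi := Ioo_mem_nhdsGT Real.pi_pos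
  have hev1 : ∀ᶠ φ in 𝓝[<] Real.pi, φ ∈ Ioo 0 Real.pi := Ioo_mem_nhdsLT Real.pi_pos
  have h := intervalIntegral.integral_eq_sub_of_hasDerivAt_of_tendsto Real.pi_pos hder
    ((hi.const_mul _).sub hi')
    (hlim _ 0 nhdsWithin_le_nhds hev0 (by simp) (by simp))
    (hlim _ Real.pi nhdsWithin_le_nhds hev1 (by simp) (by simp))
  rw [intervalIntegral.integral_sub (hi.const_mul _) hi', intervalIntegral.integral_const_mul,
    sub_zero] at h
  exact sub_eq_zero.1 h

/-- Each application of the Sturm-Liouville operator gains k² and uses two derivatives. Its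
coefficients are polynomial in s, so uniform boundedness up to s = 1 is preserved. -/
theorem UnifBdd.exists_chebyshev_decay {ι : Type*} (n : ℕ) : ∀ {u : ι → ℝ → ℂ},
    UnifBdd (Ioo (-2) 1) (2 * n + 1) u → ∃ C : ℝ, ∀ i (k : ℕ),
      (k : ℝ) ^ (2 * n) *
        ‖∫ φ in (0 : ℝ)..Real.pi, u i (Real.cos φ) * ((Real.cos (k * φ) : ℝ) : ℂ)‖ ≤ C := by
  induction n with
  | zero =>
    intro u hu
    obtain ⟨C, hC0, hC⟩ := hu.bound
    refine ⟨C * |Real.pi - 0|, fun i k => ?_⟩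
    rw [mul_zero, pow_zero, one_mul]
    refine intervalIntegral.norm_integral_le_of_norm_le_const fun φ hφ => ?_
    rw [uIoc_of_le Real.pi_pos.le] at hφ
    rw [norm_mul, Complex.norm_real]
    calc _ ≤ C * 1 := mul_le_mul (hC i _ (cos_mem_Ioo hφ)) (Real.abs_cos_le_one _)
          (abs_nonneg _) hC0
      _ = C := mul_one C
  | succ n ih =>
    intro u hu
    obtain ⟨u', hd, hu'⟩ := hu.exists_deriv
    obtain ⟨u'', hd', hu''⟩ := hu'.exists_deriv
    obtain ⟨C₀, -, hC₀⟩ := hu.bound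
    obtain ⟨C₁, -, hC₁⟩ := hu'.bound
    have hpoly : ∀ {g : ℝ → ℂ}, ContDiff ℝ ∞ g →
        UnifBdd (Ioo (-2) 1) (2 * n + 1) (fun (_ : ι) s => g s) := fun hg =>
      unifBdd_of_contDiffOn isOpen_univ isCompact_Icc (subset_univ _)
        (Ioo_subset_Icc_self) hg.contDiffOn
    have hΛ : UnifBdd (Ioo (-2) 1) (2 * n + 1) (fun i (s : ℝ) =>
        (s : ℂ) * u' i s + ((s : ℂ) ^ 2 - 1) * u'' i s) := by
      have h1 : ContDiff ℝ ∞ (fun s : ℝ => (s : ℂ)) := Complex.ofRealCLM.contDiff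
      exact (UnifBdd.mul (hpoly h1) hu'.pred).add
        (UnifBdd.mul (hpoly ((h1.pow 2).sub contDiff_const)) hu'')
    obtain ⟨C, hC⟩ := ih hΛ
    refine ⟨C, fun i k => ?_⟩
    have hk : Continuous fun φ : ℝ => ((Real.cos (k * φ) : ℝ) : ℂ) := by fun_prop
    have h := sq_mul_integral_comp_cos (hd i) (hd' i) (hC₀ i) (hC₁ i) k
      (hu.intervalIntegrable_comp_cos i hk) (hΛ.intervalIntegrable_comp_cos i hk)
    refine le_trans (le_of_eq ?_) (hC i k)
    rw [← h, norm_mul, norm_pow, Complex.norm_natCast]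
    ring

/-- Boundedness of the derivative gives a limit at the endpoint. -/
theorem UnifBdd.exists_tendsto {ι : Type*} {u : ι → ℝ → ℂ} (hu : UnifBdd (Ioo (-2) 1) 1 u)
    (i : ι) : ∃ z, Tendsto (u i) (𝓝[Ioo (-2) 1] 1) (𝓝 z) := by
  obtain ⟨u', hd, hu'⟩ := hu.exists_deriv
  obtain ⟨C, hC0, hC⟩ := hu'.bound
  have hlip : LipschitzOnWith ⟨C, hC0⟩ (u i) (Ioo (-2) 1) :=
    (convex_Ioo _ _).lipschitzOnWith_of_nnnorm_hasDerivWithin_le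
      (fun s hs => (hd i s hs).hasDerivWithinAt) fun s hs => hC i s hs
  have hbot : (𝓝[Ioo (-2 : ℝ) 1] 1).NeBot := right_nhdsWithin_Ioo_neBot (by norm_num)
  have hc : Cauchy (map (u i) (𝓝[Ioo (-2 : ℝ) 1] 1)) :=
    (cauchy_nhds.mono nhdsWithin_le_nhds).map_of_le hlip.uniformContinuousOn inf_le_right
  exact cauchy_map_iff_exists_tendsto.1 hc

/-- Expansion in Chebyshev polynomials. -/
theorem UnifBdd.hasSum_chebyshev {ι : Type*} {u : ι → ℝ → ℂ} (hu : UnifBdd (Ioo (-2) 1) 1 u)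
    (i : ι) (hs : Summable fun n : ℕ =>
      ∫ φ in (0 : ℝ)..Real.pi, u i (Real.cos φ) * ((Real.cos (n * φ) : ℝ) : ℂ))
    {s : ℝ} (hs1 : -1 ≤ s) (hs2 : s < 1) :
    HasSum (fun n : ℕ => (chebNormalization n : ℂ) *
      (∫ φ in (0 : ℝ)..Real.pi, u i (Real.cos φ) * ((Real.cos (n * φ) : ℝ) : ℂ)) *
        (chebT n s : ℂ)) (u i s) := by
  obtain ⟨z, hz⟩ := hu.exists_tendsto i
  -- With the limit as value at s = 1, φ ↦ G(cos φ) is continuous, even and 2π-periodic. Its Fourier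
  -- series, folded over ±k, is the Chebyshev series of `u`.
  let G : ℝ → ℂ := Function.update (u i) 1 z
  have hG : ∀ t, t < 1 → G t = u i t := fun t ht => Function.update_of_ne ht.ne _ _
  have hGc : ContinuousOn G (Ioc (-2) 1) := by
    rw [continuousOn_update_iff, Ioc_sdiff_right]
    exact ⟨hu.continuousOn i, fun _ => hz⟩
  let v : ℝ → ℂ := fun φ => G (Real.cos φ)
  have hv : Continuous v := hGc.comp_continuous Real.continuous_cos fun φ =>
    ⟨by linarith [Real.neg_one_le_cos φ], Real.cos_le_one φ⟩
  have hper : Function.Periodic v (2 * Real.pi) := fun φ => by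
    simp only [v, Real.cos_add_two_pi]
  have hneg : ∀ φ, v (-φ) = v φ := fun φ => by simp only [v, Real.cos_neg]
  let d : ℕ → ℂ := fun n =>
    ∫ φ in (0 : ℝ)..Real.pi, u i (Real.cos φ) * ((Real.cos (n * φ) : ℝ) : ℂ)
  have hd : ∀ n : ℕ, ∫ φ in (0 : ℝ)..Real.pi, v φ * ((Real.cos (n * φ) : ℝ) : ℂ) = d n := by
    intro n
    refine intervalIntegral.integral_congr_ae (Eventually.of_forall fun φ hφ => ?_)
    rw [uIoc_of_le Real.pi_pos.le] at hφ
    simp only [v, hG _ (cos_mem_Ioo hφ).2]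
  have hcoef : ∀ k : ℤ, (1 / ((2 * Real.pi : ℝ) : ℂ)) *
      ∫ φ in (0 : ℝ)..(2 * Real.pi), v φ * circleExp 1 (-k) φ = (1 / Real.pi : ℂ) * d k.natAbs := by
    intro k
    have hc : Continuous fun φ => v φ * circleExp 1 (-k) φ := hv.mul (continuous_circleExp 1 (-k))
    have h1 := (hper.mul (circleExp_periodic (w := 1) (by ring) (-k))).intervalIntegral_add_eq 0
      (-Real.pi)
    simp only [zero_add, Pi.mul_apply] at h1
    rw [h1, show -Real.pi + 2 * Real.pi = Real.pi by ring,
      ← intervalIntegral.integral_add_adjacent_intervals (hc.intervalIntegrable (-Real.pi) 0)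
        (hc.intervalIntegrable 0 Real.pi)]
    have h2 : ∫ φ in (-Real.pi)..0, v φ * circleExp 1 (-k) φ =
        ∫ φ in (0 : ℝ)..Real.pi, v φ * circleExp 1 (-k) (-φ) := by
      have := intervalIntegral.integral_comp_neg (a := 0) (b := Real.pi)
        (fun φ => v φ * circleExp 1 (-k) φ)
      simp only [neg_zero, hneg] at this
      exact this.symm
    rw [h2, ← intervalIntegral.integral_add
      ((by have := continuous_circleExp 1 (-k); fun_prop :
        Continuous fun φ => v φ * circleExp 1 (-k) (-φ)).intervalIntegrable 0 Real.pi)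
      (hc.intervalIntegrable 0 Real.pi), ← hd]
    have h3 : ∀ φ : ℝ, v φ * circleExp 1 (-k) (-φ) + v φ * circleExp 1 (-k) φ =
        2 * (v φ * ((Real.cos (k.natAbs * φ) : ℝ) : ℂ)) := by
      intro φ
      have hcos : Real.cos (k.natAbs * φ) = Real.cos (k * φ) := by
        rcases Int.natAbs_eq k with h | h
        · conv_rhs => rw [h]
          simp
        · conv_rhs => rw [h]
          simp
      rw [hcos]
      push_cast
      rw [Complex.cos, circleExp, circleExp]
      push_cast
      ring_nf
    simp only [h3]
    rw [intervalIntegral.integral_const_mul]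
    have : (Real.pi : ℂ) ≠ 0 := by exact_mod_cast Real.pi_ne_zero
    push_cast
    field_simp
  have hsd : Summable fun k : ℤ => (1 / Real.pi : ℂ) * d k.natAbs := by
    refine Summable.mul_left _ (Summable.of_nat_of_neg ?_ ?_)
    · simpa only [Int.natAbs_natCast] using hs
    · simpa only [Int.natAbs_neg, Int.natAbs_natCast] using hs
  have hφ : Real.cos (Real.arccos s) = s := Real.cos_arccos hs1 hs2.le
  have h1 := hasSum_circleExp (w := 1) (T := 2 * Real.pi) (by positivity) (by ring) hv hper
    (by simpa only [hcoef] using hsd) (Real.arccos s)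
  simp only [hcoef] at h1
  have hvs : v (Real.arccos s) = u i s := by simp only [v, hφ, hG s hs2]
  rw [hvs] at h1
  have h2 := h1.nat_add_neg
  have h0 : (1 / Real.pi : ℂ) * d (0 : ℤ).natAbs * circleExp 1 0 (Real.arccos s) =
      (1 / Real.pi : ℂ) * d 0 := by simp [circleExp]
  rw [h0] at h2
  -- Folding ±k counts the frequency 0 twice; one copy is removed, whence the different
  -- normalization for n = 0.
  have h3 := h2.sub (hasSum_ite_eq (0 : ℕ) ((1 / Real.pi : ℂ) * d 0))
  rw [add_sub_cancel_right] at h3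
  convert! h3 using 1
  funext n
  rcases Nat.eq_zero_or_pos n with rfl | hn
  · simp [chebNormalization, chebT, d, circleExp]
  · have hcheb : chebT n s = Real.cos (n * Real.arccos s) := by rw [← chebT_cos, hφ]
    rw [if_neg hn.ne', sub_zero, hcheb, Int.natAbs_neg, Int.natAbs_natCast, ← mul_add,
      chebNormalization, if_neg hn.ne']
    change _ * d n * _ = _
    push_cast
    rw [Complex.cos, circleExp, circleExp]
    push_cast
    ring_nf

end Chebyshev

/-! ### Integration and Fourier series on the square -/

section Square

/-- The measurable equivalence `ℝ × ℝ ≃ Plane`. -/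
def prodToPlane : ℝ × ℝ ≃ᵐ Plane :=
  MeasurableEquiv.finTwoArrow.symm.trans (MeasurableEquiv.toLp 2 (Fin 2 → ℝ))

theorem prodToPlane_apply (p : ℝ × ℝ) : prodToPlane p = !₂[p.1, p.2] := rfl

theorem measurePreserving_prodToPlane : MeasurePreserving prodToPlane :=
  (PiLp.volume_preserving_toLp (Fin 2)).comp (volume_preserving_finTwoArrow ℝ).symm

theorem preimage_unitSquare :
    prodToPlane ⁻¹' unitSquare = Icc (0 : ℝ) 1 ×ˢ Icc (0 : ℝ) 1 := by
  ext p
  simp [unitSquare, prodToPlane_apply, Fin.forall_fin_two, Prod.le_def]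
  tauto

theorem volume_unitSquare : volume unitSquare = 1 := by
  rw [← measurePreserving_prodToPlane.measure_preimage_equiv, preimage_unitSquare,
    Measure.volume_eq_prod, Measure.prod_prod]
  simp

instance isProbabilityMeasure_unitSquare :
    IsProbabilityMeasure (volume.restrict unitSquare : Measure Plane) :=
  ⟨by rw [Measure.restrict_apply_univ, volume_unitSquare]⟩

theorem continuous_plane_mk : Continuous fun p : ℝ × ℝ => (!₂[p.1, p.2] : Plane) := by
  refine (PiLp.continuous_toLp 2 _).comp (continuous_pi fun i => ?_)
  fin_cases i
  · exact continuous_fst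
  · exact continuous_snd

theorem integral_unitSquare {f : Plane → ℂ} (hf : Continuous f) :
    ∫ x in unitSquare, f x = ∫ s in (0 : ℝ)..1, ∫ t in (0 : ℝ)..1, f !₂[s, t] := by
  have hc : Continuous fun p : ℝ × ℝ => f !₂[p.1, p.2] := hf.comp continuous_plane_mk
  rw [← measurePreserving_prodToPlane.setIntegral_preimage_emb prodToPlane.measurableEmbedding,
    preimage_unitSquare, Measure.volume_eq_prod]
  simp only [prodToPlane_apply]
  rw [setIntegral_prod _ (hc.continuousOn.integrableOn_compact (isCompact_Icc.prod isCompact_Icc))]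
  simp only [integral_Icc_eq_integral_Ioc, ← intervalIntegral.integral_of_le zero_le_one]

theorem integral_unitSquare_swap {f : Plane → ℂ} (hf : Continuous f) :
    ∫ x in unitSquare, f x = ∫ t in (0 : ℝ)..1, ∫ s in (0 : ℝ)..1, f !₂[s, t] := by
  have hc : Continuous fun p : ℝ × ℝ => f !₂[p.1, p.2] := hf.comp continuous_plane_mk
  rw [integral_unitSquare hf]
  refine intervalIntegral_intervalIntegral_swap (F := fun s t => f !₂[s, t]) ?_
  rw [uIoc_of_le zero_le_one]
  exact (hc.continuousOn.integrableOn_compact (isCompact_Icc.prod isCompact_Icc)).mono_set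
    (prod_mono Ioc_subset_Icc_self Ioc_subset_Icc_self)

theorem planeWave_mk (k : Lattice) (s t : ℝ) : planeWave k !₂[s, t] =
    circleExp (2 * Real.pi) (k 0) s * circleExp (2 * Real.pi) (k 1) t := by
  rw [planeWave, circleExp, circleExp, ← Complex.exp_add, Fin.sum_univ_two]
  congr 1
  simp
  ring

theorem plane_eta (x : Plane) : x = !₂[x 0, x 1] := by
  ext i
  fin_cases i <;> rfl

theorem norm_planeWave (k : Lattice) (x : Plane) : ‖planeWave k x‖ = 1 := by
  rw [plane_eta x, planeWave_mk, norm_mul, norm_circleExp, norm_circleExp, one_mul]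

theorem continuous_planeWave (k : Lattice) : Continuous (planeWave k) := by
  unfold planeWave
  fun_prop

theorem planeWave_add (k l : Lattice) (x : Plane) :
    planeWave (k + l) x = planeWave k x * planeWave l x := by
  rw [planeWave, planeWave, planeWave, ← Complex.exp_add]
  congr 1
  simp [Fin.sum_univ_two]
  ring

theorem integral_circleExp (k : ℤ) :
    ∫ t in (0 : ℝ)..1, circleExp (2 * Real.pi) k t = if k = 0 then 1 else 0 := by
  split_ifs with hk
  · simp [hk, circleExp]
  · have h := integral_deriv_mul_circleExp (w := 2 * Real.pi) (T := 1) (mul_one _)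
      (f := fun _ => (1 : ℂ)) (f' := fun _ => 0) (fun t => hasDerivAt_const t _)
      continuous_const (fun _ => rfl) (-k)
    simp only [zero_mul, intervalIntegral.integral_zero, one_mul, neg_neg] at h
    refine (mul_eq_zero.1 h.symm).resolve_left ?_
    simp [hk, Real.pi_ne_zero]

theorem integral_planeWave (k : Lattice) :
    ∫ x in unitSquare, planeWave k x = if k = 0 then 1 else 0 := by
  rw [integral_unitSquare (continuous_planeWave k)]
  simp only [planeWave_mk, intervalIntegral.integral_const_mul,
    intervalIntegral.integral_mul_const, integral_circleExp]
  have : k = 0 ↔ k 0 = 0 ∧ k 1 = 0 := by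
    rw [funext_iff, Fin.forall_fin_two]; rfl
  simp only [this]
  split_ifs <;> simp_all

/-- Fourier inversion on the periodized square. -/
theorem hasSum_planeWave {g : Plane → ℂ} (hg : Continuous g)
    (hper : ∀ (i : Fin 2) (x : Plane), g (x + EuclideanSpace.single i 1) = g x)
    (hs : Summable fun l : Lattice => ∫ x in unitSquare, g x * planeWave (-l) x) (x : Plane) :
    HasSum (fun l : Lattice => (∫ x in unitSquare, g x * planeWave (-l) x) * planeWave l x)
      (g x) := by
  let w : ℝ := 2 * Real.pi
  have hw : w * 1 = 2 * Real.pi := mul_one _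
  have hmk : Continuous fun p : ℝ × ℝ => g !₂[p.1, p.2] := hg.comp continuous_plane_mk
  have hper0 : ∀ t, Function.Periodic (fun s : ℝ => g !₂[s, t]) 1 := by
    intro t s
    have h := hper 0 !₂[s, t]
    rw [show (!₂[s, t] : Plane) + EuclideanSpace.single 0 1 = !₂[s + 1, t] by
      ext i; fin_cases i <;> simp] at h
    exact h
  have hper1 : ∀ s, Function.Periodic (fun t : ℝ => g !₂[s, t]) 1 := by
    intro s t
    have h := hper 1 !₂[s, t]
    rw [show (!₂[s, t] : Plane) + EuclideanSpace.single 1 1 = !₂[s, t + 1] by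
      ext i; fin_cases i <;> simp] at h
    exact h
  -- Fourier coefficients in the second coordinate, as functions of the first. One-variable
  -- inversion is applied first to each `c k`, then to g along the second coordinate; this is why
  -- the frequencies in `d` appear in reversed order.
  let c : ℤ → ℝ → ℂ := fun k s => ∫ t in (0 : ℝ)..1, g !₂[s, t] * circleExp w (-k) t
  have hc : ∀ k, Continuous (c k) := fun k => by
    refine intervalIntegral.continuous_parametric_intervalIntegral_of_continuous' ?_ 0 1
    exact hmk.mul ((continuous_circleExp w (-k)).comp continuous_snd)
  have hcper : ∀ k, Function.Periodic (c k) 1 := fun k s => by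
    simp only [c, (hper0 _ s : g !₂[s + 1, _] = _)]
  let d : ℤ × ℤ → ℂ := fun p => ∫ s in (0 : ℝ)..1, c p.1 s * circleExp w (-p.2) s
  have hd : ∀ l : Lattice, ∫ x in unitSquare, g x * planeWave (-l) x = d (l 1, l 0) := by
    intro l
    rw [integral_unitSquare (f := fun x => g x * planeWave (-l) x)
      (hg.mul (continuous_planeWave _))]
    simp only [d, c, planeWave_mk, ← intervalIntegral.integral_mul_const]
    refine intervalIntegral.integral_congr fun s _ => intervalIntegral.integral_congr fun t _ => ?_
    simp only [Pi.neg_apply]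
    ring
  let e : ℤ × ℤ ≃ Lattice := (Equiv.prodComm ℤ ℤ).trans (finTwoArrowEquiv ℤ).symm
  have hde : ∀ p, d p = ∫ x in unitSquare, g x * planeWave (-(e p)) x := fun p => by
    rw [hd]; rfl
  have hds : Summable d := by
    have := e.summable_iff.2 hs
    simpa only [Function.comp_def, ← hde] using this
  have hterm : ∀ p, (∫ x in unitSquare, g x * planeWave (-(e p)) x) * planeWave (e p) x =
      d p * circleExp w p.2 (x 0) * circleExp w p.1 (x 1) := by
    intro p
    rw [← hde, plane_eta x, planeWave_mk, mul_assoc]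
    rfl
  have hsum : Summable fun p : ℤ × ℤ => d p * circleExp w p.2 (x 0) * circleExp w p.1 (x 1) := by
    refine Summable.of_norm ?_
    simpa only [norm_mul, norm_circleExp, mul_one] using hds.norm
  have hin : ∀ k, HasSum (fun j : ℤ => d (k, j) * circleExp w j (x 0)) (c k (x 0)) := by
    intro k
    have := hasSum_circleExp (w := w) (T := 1) one_pos hw (hc k) (hcper k)
      (by simpa using! hds.prod_factor k) (x 0)
    simpa using! this
  have hcs : Summable fun k => c k (x 0) := by
    have h1 : Summable fun p : ℤ × ℤ => d p * circleExp w p.2 (x 0) := by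
      refine Summable.of_norm ?_
      simpa only [norm_mul, norm_circleExp, mul_one] using hds.norm
    exact (h1.hasSum.prod_fiberwise fun k => hin k).summable
  have hout : HasSum (fun k => c k (x 0) * circleExp w k (x 1)) (g !₂[x 0, x 1]) := by
    have := hasSum_circleExp (w := w) (T := 1) one_pos hw
      (hmk.comp (continuous_const.prodMk continuous_id)) (hper1 (x 0))
      (by simpa using! hcs) (x 1)
    simpa using! this
  have htot := hsum.hasSum.prod_fiberwise fun k => (hin k).mul_right (circleExp w k (x 1))
  have heq := htot.unique hout
  rw [← plane_eta x] at heq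
  refine e.hasSum_iff.1 ?_
  simp only [Function.comp_def, hterm]
  rw [← heq]
  exact hsum.hasSum

end Square

/-! ### Rapid decay of the interaction matrix -/

section Coefficients

variable {m L : ℝ} {a : Plane → Plane → ℂ} {b : ℕ → Plane → ℝ → ℂ}

theorem fourierSymbol_eq (m : ℝ) (a : Plane → Plane → ℂ) (l : Lattice) (ξ : Plane) :
    fourierSymbol m a l ξ = ∫ x in unitSquare, normalizedSymbol m a x ξ * planeWave (-l) x := by
  rw [fourierSymbol, ← integral_const_mul]
  simp only [normalizedSymbol, mul_assoc]

theorem IsSymbol.continuous_normalizedSymbol (ha : IsSymbol m a) (ξ : Plane) :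
    Continuous fun x => normalizedSymbol m a x ξ :=
  continuous_const.mul (ha.contDiff_left ξ).continuous

theorem UnifBdd.mul_const {ι κ : Type*} {D : Set ℝ} {n : ℕ} {f : ι → ℝ → ℂ} (hf : UnifBdd D n f)
    (g : κ → ι) {c : κ → ℂ} (hc : ∀ k, ‖c k‖ = 1) : UnifBdd D n (fun k t => f (g k) t * c k) :=
  UnifBdd.mul (hf.reindex g) (UnifBdd.const fun k => (hc k).le)

/-- Fubini puts the integral in x_i inside, with the other coordinate as a parameter; the
one-variable decay is uniform in that parameter and in ξ. -/
theorem IsSymbol.exists_fourierSymbol_decay_coord (ha : IsSymbol m a) (hper : PeriodicInX a)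
    (i : Fin 2) (n : ℕ) :
    ∃ C : ℝ, ∀ (l : Lattice) (ξ : Plane), |(l i : ℝ)| ^ n * ‖fourierSymbol m a l ξ‖ ≤ C := by
  obtain ⟨C, hC⟩ := (ha.unifBdd_line (m := m) i (n + 1)).exists_fourier_decay
    (w := 2 * Real.pi) (T := 1) Real.two_pi_pos (mul_one _) n (fun p t => by
      simp only [normalizedSymbol]
      rw [add_smul, one_smul, ← add_assoc, hper])
  have key : ∀ (l : Lattice) (ξ : Plane) (v : ℝ → Plane) (j : Fin 2),
      fourierSymbol m a l ξ = ∫ t in (0 : ℝ)..1, (∫ s in (0 : ℝ)..1, normalizedSymbol m a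
        (v t + s • EuclideanSpace.single i 1) ξ * circleExp (2 * Real.pi) (-l i) s) *
          circleExp (2 * Real.pi) (-l j) t →
      |(l i : ℝ)| ^ n * ‖fourierSymbol m a l ξ‖ ≤ C := by
    intro l ξ v j h
    rw [h, ← Real.norm_of_nonneg (pow_nonneg (abs_nonneg (l i : ℝ)) n), ← Complex.norm_real,
      ← norm_mul, ← intervalIntegral.integral_const_mul]
    refine (intervalIntegral.norm_integral_le_of_norm_le_const (C := C) fun t _ => ?_).trans_eq
      (by simp)
    rw [norm_mul, norm_mul, norm_circleExp, mul_one, Complex.norm_real,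
      Real.norm_of_nonneg (pow_nonneg (abs_nonneg (l i : ℝ)) n)]
    exact hC (v t, ξ) (l i)
  refine ⟨C, fun l ξ => ?_⟩
  have hcont : Continuous fun x => normalizedSymbol m a x ξ * planeWave (-l) x :=
    (ha.continuous_normalizedSymbol ξ).mul (continuous_planeWave (-l))
  fin_cases i
  · refine key l ξ (fun t => !₂[0, t]) 1 ?_
    rw [fourierSymbol_eq, integral_unitSquare_swap hcont]
    simp only [planeWave_mk, ← intervalIntegral.integral_mul_const]
    refine intervalIntegral.integral_congr fun t _ => intervalIntegral.integral_congr fun s _ => ?_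
    have : (!₂[0, t] : Plane) + s • EuclideanSpace.single 0 1 = !₂[s, t] := by
      ext i; fin_cases i <;> simp
    simp [this, mul_assoc]
  · refine key l ξ (fun t => !₂[t, 0]) 0 ?_
    rw [fourierSymbol_eq, integral_unitSquare hcont]
    simp only [planeWave_mk, ← intervalIntegral.integral_mul_const]
    refine intervalIntegral.integral_congr fun t _ => intervalIntegral.integral_congr fun s _ => ?_
    have : (!₂[t, 0] : Plane) + s • EuclideanSpace.single 1 1 = !₂[t, s] := by
      ext i; fin_cases i <;> simp
    simp [this]
    ring

theorem IsSymbol.unifBdd_fourierSymbol_angle (ha : IsSymbol m a) (n : ℕ) :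
    UnifBdd univ n (fun (p : Lattice × ℝ) θ => fourierSymbol m a p.1 (polarPoint θ p.2)) := by
  simp only [fourierSymbol_eq]
  refine UnifBdd.integral (f := fun (p : Lattice × ℝ) x θ =>
    normalizedSymbol m a x (polarPoint θ p.2) * planeWave (-p.1) x) isOpen_univ
    (fun p θ _ => ((ha.continuous_normalizedSymbol _).mul
      (continuous_planeWave _)).aestronglyMeasurable) ?_
  exact (ha.unifBdd_angle n).mul_const (κ := (Lattice × ℝ) × Plane) (fun q => (q.2, q.1.2))
    (c := fun q => planeWave (-q.1.1) q.2) fun q => norm_planeWave _ _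

theorem IsSymbol.continuous_fourierSymbol_angle (ha : IsSymbol m a) (l : Lattice) (r : ℝ) :
    Continuous fun θ => fourierSymbol m a l (polarPoint θ r) :=
  continuousOn_univ.1 ((ha.unifBdd_fourierSymbol_angle (0 + 1)).continuousOn (l, r))

theorem polarPoint_periodic (r : ℝ) : Function.Periodic (fun θ => polarPoint θ r) (2 * Real.pi) :=
  fun θ => by simp [polarPoint]

/-- The angular Fourier coefficients of `h_λ`, as a function of the radius. -/
def angularCoeff (m : ℝ) (a : Plane → Plane → ℂ) (p : Lattice × ℤ) (r : ℝ) : ℂ :=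
  ∫ θ in (0 : ℝ)..(2 * Real.pi), fourierSymbol m a p.1 (polarPoint θ r) * circleExp 1 (-p.2) θ

theorem IsSymbol.exists_angularCoeff_decay (ha : IsSymbol m a) (n : ℕ) :
    ∃ C : ℝ, ∀ (p : Lattice × ℤ) (r : ℝ), |(p.2 : ℝ)| ^ n * ‖angularCoeff m a p r‖ ≤ C := by
  obtain ⟨C, hC⟩ := (ha.unifBdd_fourierSymbol_angle (n + 1)).exists_fourier_decay
    (w := 1) (T := 2 * Real.pi) one_pos (one_mul _) n
    (fun p θ => by
      have := polarPoint_periodic p.2 θ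
      simp only at this
      simp only [this])
  exact ⟨C, fun p r => hC (p.1, r) p.2⟩

theorem IsSymbol.exists_angularCoeff_decay_coord (ha : IsSymbol m a) (hper : PeriodicInX a)
    (i : Fin 2) (n : ℕ) : ∃ C : ℝ, ∀ (p : Lattice × ℤ) (r : ℝ),
      |(p.1 i : ℝ)| ^ n * ‖angularCoeff m a p r‖ ≤ C := by
  obtain ⟨C, hC⟩ := ha.exists_fourierSymbol_decay_coord hper i n
  refine ⟨C * |2 * Real.pi - 0|, fun p r => ?_⟩
  rw [angularCoeff, ← Real.norm_of_nonneg (pow_nonneg (abs_nonneg (p.1 i : ℝ)) n),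
    ← Complex.norm_real, ← norm_mul, ← intervalIntegral.integral_const_mul]
  refine intervalIntegral.norm_integral_le_of_norm_le_const fun t _ => ?_
  rw [norm_mul, norm_mul, norm_circleExp, mul_one, Complex.norm_real,
    Real.norm_of_nonneg (pow_nonneg (abs_nonneg (p.1 i : ℝ)) n)]
  exact hC _ _

/-- The bounds on the rays are uniform in (x, θ), so they survive the integrations over x and then
θ; the exponentials have modulus 1, hence uniformity in λ and k. -/
theorem IsClassicalSymbol.unifBdd_angularCoeff (hL : 0 < L) (ha : IsClassicalSymbol m a b)
    (hb : TemperedGrowth b) (n : ℕ) :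
    UnifBdd (Iio 1) n (fun p s => angularCoeff m a p (algebraicMap L s)) := by
  have hf : UnifBdd (Iio 1) n (fun (p : Lattice × ℝ) s =>
      fourierSymbol m a p.1 (polarPoint p.2 (algebraicMap L s))) := by
    simp only [fourierSymbol_eq]
    refine UnifBdd.integral (f := fun (p : Lattice × ℝ) x s =>
      normalizedSymbol m a x (polarPoint p.2 (algebraicMap L s)) * planeWave (-p.1) x) isOpen_Iio
      (fun p θ _ => ((ha.isSymbol.continuous_normalizedSymbol _).mul
        (continuous_planeWave _)).aestronglyMeasurable) ?_
    exact (ha.unifBdd_ray hL hb n).mul_const (κ := (Lattice × ℝ) × Plane)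
      (fun q => (q.2, q.1.2)) (c := fun q => planeWave (-q.1.1) q.2) fun q => norm_planeWave _ _
  simp only [angularCoeff, intervalIntegral.integral_of_le Real.two_pi_pos.le]
  refine UnifBdd.integral (f := fun (p : Lattice × ℤ) θ s =>
    fourierSymbol m a p.1 (polarPoint θ (algebraicMap L s)) * circleExp 1 (-p.2) θ) isOpen_Iio
    (fun p s _ => ((ha.isSymbol.continuous_fourierSymbol_angle _ _).mul
      (continuous_circleExp _ _)).aestronglyMeasurable) ?_
  exact hf.mul_const (κ := (Lattice × ℤ) × ℝ) (fun q => (q.1.1, q.2))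
    (c := fun q => circleExp 1 (-q.1.2) q.2) fun q => norm_circleExp _ _ _

/-- The cosine moments of the angular coefficients. -/
def cosineMoment (m L : ℝ) (a : Plane → Plane → ℂ) (p : Lattice × ℤ) (n : ℕ) : ℂ :=
  ∫ φ in (0 : ℝ)..Real.pi, angularCoeff m a p (algebraicMap L (Real.cos φ)) *
    ((Real.cos (n * φ) : ℝ) : ℂ)

theorem interactionCoeff_eq (m L : ℝ) (a : Plane → Plane → ℂ) (l : Lattice) (k : ℤ) (n : ℕ) :
    interactionCoeff m L a l k n =
      ((chebNormalization n / (2 * Real.pi) : ℝ) : ℂ) * cosineMoment m L a (l, k) n := by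
  rw [interactionCoeff, cosineMoment, ← integral_chebyshev_eq fun s =>
    angularCoeff m a (l, k) (algebraicMap L s)]
  congr 1
  refine intervalIntegral.integral_congr fun s _ => ?_
  simp only [intervalIntegral.integral_mul_const, angularCoeff, circleExp]
  congr 2
  funext θ
  congr 2
  push_cast
  ring

theorem exists_cosineMoment_bound {c : Lattice × ℤ → ℝ} {C : ℝ} (hc : ∀ p, 0 ≤ c p)
    (h : ∀ p r, c p * ‖angularCoeff m a p r‖ ≤ C) (p : Lattice × ℤ) (n : ℕ) :
    c p * ‖cosineMoment m L a p n‖ ≤ C * Real.pi := by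
  rw [cosineMoment, ← Real.norm_of_nonneg (hc p), ← Complex.norm_real, ← norm_mul,
    ← intervalIntegral.integral_const_mul]
  refine (intervalIntegral.norm_integral_le_of_norm_le_const (C := C) fun t _ => ?_).trans_eq
    (by rw [sub_zero, abs_of_pos Real.pi_pos])
  rw [norm_mul, norm_mul, Complex.norm_real, Complex.norm_real, Real.norm_of_nonneg (hc p),
    ← mul_assoc]
  exact (mul_le_of_le_one_right (mul_nonneg (hc p) (norm_nonneg _)) (Real.abs_cos_le_one _)).trans
    (h p _)

/-- The size of an index of the interaction matrix. -/
def indexSize (p : Lattice × ℤ × ℕ) : ℕ :=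
  max (max (p.1 0).natAbs (p.1 1).natAbs) (max p.2.1.natAbs p.2.2)

theorem chebNormalization_nonneg (n : ℕ) : 0 ≤ chebNormalization n := by
  rw [chebNormalization]; split_ifs <;> positivity

theorem chebNormalization_le (n : ℕ) : chebNormalization n / (2 * Real.pi) ≤ 1 := by
  have := Real.pi_gt_three
  rw [div_le_one (by positivity), chebNormalization]
  split_ifs
  · rw [div_le_iff₀ (by positivity)]; nlinarith
  · rw [div_le_iff₀ (by positivity)]; nlinarith

theorem norm_interactionCoeff_le (m L : ℝ) (a : Plane → Plane → ℂ) (p : Lattice × ℤ × ℕ) :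
    ‖interactionCoeff m L a p.1 p.2.1 p.2.2‖ ≤ ‖cosineMoment m L a (p.1, p.2.1) p.2.2‖ := by
  rw [interactionCoeff_eq, norm_mul, Complex.norm_real, Real.norm_of_nonneg
    (div_nonneg (chebNormalization_nonneg _) (by positivity))]
  exact mul_le_of_le_one_left (norm_nonneg _) (chebNormalization_le _)

/-- The cosine moments decrease faster than any power of the index. -/
theorem IsClassicalSymbol.exists_cosineMoment_decay (hL : 0 < L)
    (ha : IsClassicalSymbol m a b) (hb : TemperedGrowth b) (N : ℕ) :
    ∃ C : ℝ, 0 < C ∧ ∀ p : Lattice × ℤ × ℕ,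
      ((indexSize p : ℝ) + 1) ^ N * ‖cosineMoment m L a (p.1, p.2.1) p.2.2‖ ≤ C := by
  -- The size is one of its four entries, so decay in each entry separately suffices. Even powers
  -- are what the Chebyshev estimate provides.
  have hmom : ∀ n : ℕ, ∃ C : ℝ, ∀ p : Lattice × ℤ × ℕ,
      (indexSize p : ℝ) ^ (2 * n) * ‖cosineMoment m L a (p.1, p.2.1) p.2.2‖ ≤ C := by
    intro n
    obtain ⟨C₀, hC₀⟩ := ha.isSymbol.exists_angularCoeff_decay_coord ha.periodic 0 (2 * n)
    obtain ⟨C₁, hC₁⟩ := ha.isSymbol.exists_angularCoeff_decay_coord ha.periodic 1 (2 * n)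
    obtain ⟨C₂, hC₂⟩ := ha.isSymbol.exists_angularCoeff_decay (2 * n)
    obtain ⟨C₃, hC₃⟩ := UnifBdd.exists_chebyshev_decay n
      ((ha.unifBdd_angularCoeff hL hb (2 * n + 1)).mono_set (D' := Ioo (-2) 1) fun s hs => hs.2)
    have h₀ := exists_cosineMoment_bound (L := L) (fun p => by positivity) hC₀
    have h₁ := exists_cosineMoment_bound (L := L) (fun p => by positivity) hC₁
    have h₂ := exists_cosineMoment_bound (L := L) (fun p => by positivity) hC₂
    refine ⟨max (max (C₀ * Real.pi) (C₁ * Real.pi)) (max (C₂ * Real.pi) C₃), fun p => ?_⟩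
    have hcast : ∀ z : ℤ, ((z.natAbs : ℕ) : ℝ) = |(z : ℝ)| := fun z => by
      rw [Nat.cast_natAbs, Int.cast_abs]
    rw [indexSize]
    rcases max_choice (max (p.1 0).natAbs (p.1 1).natAbs) (max p.2.1.natAbs p.2.2) with h | h <;>
      rw [h]
    · refine le_trans ?_ (le_max_left _ _)
      rcases max_choice (p.1 0).natAbs (p.1 1).natAbs with h | h <;> rw [h, hcast]
      · exact (h₀ (p.1, p.2.1) p.2.2).trans (le_max_left _ _)
      · exact (h₁ (p.1, p.2.1) p.2.2).trans (le_max_right _ _)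
    · refine le_trans ?_ (le_max_right _ _)
      rcases max_choice p.2.1.natAbs p.2.2 with h | h <;> rw [h]
      · rw [hcast]
        exact (h₂ (p.1, p.2.1) p.2.2).trans (le_max_left _ _)
      · exact (hC₃ (p.1, p.2.1) p.2.2).trans (le_max_right _ _)
  obtain ⟨C₀, hC₀⟩ := hmom 0
  obtain ⟨C₁, hC₁⟩ := hmom N
  have hC₀' : 0 ≤ C₀ := le_trans (by positivity) (hC₀ (0, 0, 0))
  have hC₁' : 0 ≤ C₁ := le_trans (by positivity) (hC₁ (0, 0, 0))
  refine ⟨2 ^ (2 * N) * (C₀ + C₁) + 1, by positivity, fun p => ?_⟩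
  -- Passing from N to 2N reduces the claim to the even moments 0 and 2N.
  have h2 : ((indexSize p : ℝ) + 1) ^ N ≤ 2 ^ (2 * N) * ((indexSize p : ℝ) ^ (2 * N) + 1) := by
    have hs : (0 : ℝ) ≤ indexSize p := by positivity
    have h3 : ((indexSize p : ℝ) + 1) ^ (2 * N) ≤
        2 ^ (2 * N - 1) * ((indexSize p : ℝ) ^ (2 * N) + 1 ^ (2 * N)) :=
      add_pow_le hs zero_le_one _
    rw [one_pow] at h3
    calc ((indexSize p : ℝ) + 1) ^ N ≤ ((indexSize p : ℝ) + 1) ^ (2 * N) :=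
          pow_le_pow_right₀ (by linarith) (by omega)
      _ ≤ _ := h3
      _ ≤ _ := by
          gcongr
          · norm_num
          · omega
  have h4 := hC₀ p
  have h5 := hC₁ p
  rw [mul_zero, pow_zero, one_mul] at h4
  calc _ ≤ (2 ^ (2 * N) * ((indexSize p : ℝ) ^ (2 * N) + 1)) *
        ‖cosineMoment m L a (p.1, p.2.1) p.2.2‖ := by gcongr
    _ = 2 ^ (2 * N) * ((indexSize p : ℝ) ^ (2 * N) * ‖cosineMoment m L a (p.1, p.2.1) p.2.2‖ +
        ‖cosineMoment m L a (p.1, p.2.1) p.2.2‖) := by ring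
    _ ≤ 2 ^ (2 * N) * (C₁ + C₀) := by gcongr
    _ ≤ _ := by linarith

end Coefficients

/-! ### Convergence of the expansion and size of its tails -/

section Expansion

variable {m L : ℝ} {a : Plane → Plane → ℂ} {b : ℕ → Plane → ℝ → ℂ}

/-- The exponent 8 is twice the number of integer coordinates: an inverse square is available for
each of the four. -/
theorem summable_indexSize :
    Summable fun p : Lattice × ℤ × ℕ => (((indexSize p : ℝ) + 1) ^ 8)⁻¹ := by
  have hN : Summable fun n : ℕ => (((n : ℝ) + 1) ^ 2)⁻¹ := by
    have := (summable_nat_add_iff 1).2 (Real.summable_nat_pow_inv.2 (one_lt_two))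
    simpa using this
  have hZ : Summable fun k : ℤ => (((k.natAbs : ℝ) + 1) ^ 2)⁻¹ :=
    Summable.of_nat_of_neg (by simpa using hN) (by simpa using hN)
  have hnn : ∀ x : ℝ, 0 ≤ ((x + 1) ^ 2)⁻¹ := fun x => by positivity
  have hZZ := hZ.mul_of_nonneg hZ (fun _ => hnn _) (fun _ => hnn _)
  have hlat : Summable fun l : Lattice =>
      ((((l 0).natAbs : ℝ) + 1) ^ 2)⁻¹ * ((((l 1).natAbs : ℝ) + 1) ^ 2)⁻¹ :=
    (finTwoArrowEquiv ℤ).summable_iff.2 hZZ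
  have htot := hlat.mul_of_nonneg (hZ.mul_of_nonneg hN (fun _ => hnn _) (fun _ => hnn _))
    (fun _ => mul_nonneg (hnn _) (hnn _)) (fun _ => mul_nonneg (hnn _) (hnn _))
  refine Summable.of_nonneg_of_le (fun p => by positivity) (fun p => ?_) htot
  rw [← mul_inv, ← mul_inv, ← mul_inv]
  refine inv_anti₀ (by positivity) ?_
  have h0 : (p.1 0).natAbs ≤ indexSize p := (le_max_left _ _).trans (le_max_left _ _)
  have h1 : (p.1 1).natAbs ≤ indexSize p := (le_max_right _ _).trans (le_max_left _ _)
  have h2 : p.2.1.natAbs ≤ indexSize p := (le_max_left _ _).trans (le_max_right _ _)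
  have h3 : p.2.2 ≤ indexSize p := (le_max_right _ _).trans (le_max_right _ _)
  calc _ ≤ (((indexSize p : ℝ) + 1) ^ 2 * ((indexSize p : ℝ) + 1) ^ 2) *
        (((indexSize p : ℝ) + 1) ^ 2 * ((indexSize p : ℝ) + 1) ^ 2) := by gcongr
    _ = _ := by ring

theorem IsClassicalSymbol.summable_norm_cosineMoment (hL : 0 < L) (ha : IsClassicalSymbol m a b)
    (hb : TemperedGrowth b) :
    Summable fun p : Lattice × ℤ × ℕ => ‖cosineMoment m L a (p.1, p.2.1) p.2.2‖ := by
  obtain ⟨C, -, hC⟩ := ha.exists_cosineMoment_decay hL hb 8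
  refine Summable.of_nonneg_of_le (fun _ => norm_nonneg _) (fun p => ?_)
    (summable_indexSize.mul_left C)
  rw [← div_eq_mul_inv, le_div_iff₀ (by positivity), mul_comm]
  exact hC p

theorem IsClassicalSymbol.summable_norm_interactionCoeff (hL : 0 < L)
    (ha : IsClassicalSymbol m a b) (hb : TemperedGrowth b) :
    Summable fun p : Lattice × ℤ × ℕ => ‖interactionCoeff m L a p.1 p.2.1 p.2.2‖ :=
  Summable.of_nonneg_of_le (fun _ => norm_nonneg _) (norm_interactionCoeff_le m L a)
    (ha.summable_norm_cosineMoment hL hb)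

/-- A summable double family may be summed by iterating two summations. -/
theorem hasSum_of_iterated {α β : Type*} {f : α × β → ℂ} {g : α → ℂ} {c : ℂ} (hf : Summable f)
    (hfg : ∀ x, HasSum (fun y => f (x, y)) (g x)) (hg : Summable g → HasSum g c) : HasSum f c := by
  have h := hf.hasSum.prod_fiberwise hfg
  rw [← h.unique (hg h.summable)]
  exact hf.hasSum

theorem ratCheb_param_mem (hL : 0 < L) {r : ℝ} (hr : 0 ≤ r) :
    -1 ≤ (r - L) / (r + L) ∧ (r - L) / (r + L) < 1 := by
  constructor
  · rw [le_div_iff₀ (by linarith)]; linarith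
  · rw [div_lt_one (by linarith)]; linarith

theorem abs_ratCheb_le_one (hL : 0 < L) (n : ℕ) {r : ℝ} (hr : 0 ≤ r) : |ratCheb L n r| ≤ 1 := by
  have h := ratCheb_param_mem hL hr
  exact abs_chebT_le_one n (abs_le.2 ⟨h.1, h.2.le⟩)

theorem algebraicMap_ratCheb_param (hL : 0 < L) {r : ℝ} (hr : 0 ≤ r) :
    algebraicMap L ((r - L) / (r + L)) = r := by
  have h1 : r + L ≠ 0 := by linarith
  rw [algebraicMap_eq (ratCheb_param_mem hL hr).2,
    show 1 - (r - L) / (r + L) = 2 * L / (r + L) by field_simp; ring]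
  field_simp
  ring

theorem freqBasis_eq (L : ℝ) (k : ℤ) (n : ℕ) (ξ : Plane) :
    freqBasis L k n ξ = circleExp 1 k (polarArg ξ) * (ratCheb L n ‖ξ‖ : ℂ) := by
  rw [freqBasis, circleExp, one_mul]

theorem norm_freqBasis_le_one (hL : 0 < L) (k : ℤ) (n : ℕ) (ξ : Plane) :
    ‖freqBasis L k n ξ‖ ≤ 1 := by
  rw [freqBasis_eq, norm_mul, norm_circleExp, one_mul, Complex.norm_real]
  exact abs_ratCheb_le_one hL n (norm_nonneg ξ)

theorem polarPoint_polarArg (ξ : Plane) : polarPoint (polarArg ξ) ‖ξ‖ = ξ := by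
  have hn : ‖ξ‖ = ‖(⟨ξ 0, ξ 1⟩ : ℂ)‖ := by
    rw [EuclideanSpace.norm_eq, Complex.norm_eq_sqrt_sq_add_sq, Fin.sum_univ_two]
    simp
  rw [polarPoint, hn, polarArg, Complex.norm_mul_cos_arg, Complex.norm_mul_sin_arg]
  exact (plane_eta ξ).symm

/-- The rational Chebyshev expansion of a classical symbol converges to the symbol. -/
theorem IsClassicalSymbol.hasSum_expansion (hL : 0 < L) (ha : IsClassicalSymbol m a b)
    (hb : TemperedGrowth b) (x ξ : Plane) :
    HasSum (fun p : Lattice × ℤ × ℕ => interactionCoeff m L a p.1 p.2.1 p.2.2 *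
      planeWave p.1 x * freqBasis L p.2.1 p.2.2 ξ) (normalizedSymbol m a x ξ) := by
  set r := ‖ξ‖ with hr
  have hr0 : 0 ≤ r := norm_nonneg ξ
  set θ := polarArg ξ with hθ
  have hcoef := ha.summable_norm_interactionCoeff hL hb
  have hs1 : Summable fun p : Lattice × ℤ × ℕ => interactionCoeff m L a p.1 p.2.1 p.2.2 *
      freqBasis L p.2.1 p.2.2 ξ := by
    refine Summable.of_norm_bounded hcoef fun p => ?_
    rw [norm_mul]
    exact mul_le_of_le_one_right (norm_nonneg _) (norm_freqBasis_le_one hL _ _ _)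
  have hs2 : Summable fun p : Lattice × ℤ × ℕ => interactionCoeff m L a p.1 p.2.1 p.2.2 *
      planeWave p.1 x * freqBasis L p.2.1 p.2.2 ξ := by
    refine Summable.of_norm_bounded hs1.norm fun p => ?_
    rw [norm_mul, norm_mul, norm_mul, norm_planeWave, mul_one]
  have hs3 : Summable fun p : Lattice × ℤ × ℕ => interactionCoeff m L a p.1 p.2.1 p.2.2 *
      (ratCheb L p.2.2 r : ℂ) := by
    refine Summable.of_norm_bounded hcoef fun p => ?_
    rw [norm_mul, Complex.norm_real]
    exact mul_le_of_le_one_right (norm_nonneg _) (abs_ratCheb_le_one hL _ hr0)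
  -- Three inversions are nested: Chebyshev in n, Fourier in k, Fourier in λ. Absolute summability
  -- of the coefficients both justifies the iteration and supplies the summability each inversion
  -- theorem asks for.
  have hradial : ∀ (l : Lattice) (k : ℤ), HasSum (fun n : ℕ => interactionCoeff m L a l k n *
      (ratCheb L n r : ℂ)) (1 / ((2 * Real.pi : ℝ) : ℂ) * angularCoeff m a (l, k) r) := by
    intro l k
    have hmom : Summable fun n : ℕ => cosineMoment m L a (l, k) n :=
      ((ha.summable_norm_cosineMoment hL hb).of_norm.prod_factor l).prod_factor k
    have h := (UnifBdd.hasSum_chebyshev ((ha.unifBdd_angularCoeff hL hb 1).mono_set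
      (D' := Ioo (-2) 1) fun s hs => hs.2) (l, k) hmom (ratCheb_param_mem hL hr0).1
      (ratCheb_param_mem hL hr0).2).mul_left (1 / ((2 * Real.pi : ℝ) : ℂ))
    rw [algebraicMap_ratCheb_param hL hr0] at h
    convert! h using 1
    funext n
    rw [interactionCoeff_eq, ratCheb, cosineMoment]
    push_cast
    ring
  have hangular : ∀ l : Lattice, HasSum (fun q : ℤ × ℕ => interactionCoeff m L a l q.1 q.2 *
      freqBasis L q.1 q.2 ξ) (fourierSymbol m a l ξ) := by
    intro l
    have hk : Summable fun k : ℤ => 1 / ((2 * Real.pi : ℝ) : ℂ) * angularCoeff m a (l, k) r :=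
      ((hs3.prod_factor l).hasSum.prod_fiberwise fun k => hradial l k).summable
    refine hasSum_of_iterated (hs1.prod_factor l)
      (g := fun k => 1 / ((2 * Real.pi : ℝ) : ℂ) * angularCoeff m a (l, k) r * circleExp 1 k θ)
      (fun k => ?_) fun _ => ?_
    · convert! (hradial l k).mul_right (circleExp 1 k θ) using 1
      funext n
      rw [freqBasis_eq]
      ring
    · have := hasSum_circleExp Real.two_pi_pos (one_mul _)
        (ha.isSymbol.continuous_fourierSymbol_angle l r)
        (fun θ => by
          have := polarPoint_periodic r θ
          simp only at this
          simp only [this]) hk θ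
      rwa [hθ, hr, polarPoint_polarArg] at this
  refine hasSum_of_iterated hs2 (g := fun l => fourierSymbol m a l ξ * planeWave l x)
    (fun l => ?_) fun hg => ?_
  · convert! (hangular l).mul_right (planeWave l x) using 1
    funext q
    ring
  · simp only [fourierSymbol_eq] at hg ⊢
    refine hasSum_planeWave (ha.isSymbol.continuous_normalizedSymbol ξ)
      (fun i x => by simp only [normalizedSymbol, ha.periodic i x ξ]) ?_ x
    refine Summable.of_norm ?_
    simpa only [norm_mul, norm_planeWave, mul_one] using hg.norm

/-- The finite box of indices of size at most `K`. -/
def indexBox (K : ℕ) : Finset (Lattice × ℤ × ℕ) :=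
  (Fintype.piFinset fun _ : Fin 2 => Finset.Icc (-(K : ℤ)) K) ×ˢ
    Finset.Icc (-(K : ℤ)) K ×ˢ Finset.range (K + 1)

theorem card_indexBox_le (K : ℕ) : (indexBox K).card ≤ (2 * K + 1) ^ 4 := by
  rw [indexBox, Finset.card_product, Finset.card_product, Fintype.card_piFinset_const,
    Finset.card_range, Int.card_Icc]
  have h : ((K : ℤ) + 1 - -(K : ℤ)).toNat = 2 * K + 1 := by omega
  rw [h]
  calc (2 * K + 1) ^ 2 * ((2 * K + 1) * (K + 1)) ≤
      (2 * K + 1) ^ 2 * ((2 * K + 1) * (2 * K + 1)) := by gcongr; omega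
    _ = _ := by ring

theorem indexSize_of_notMem {K : ℕ} {p : Lattice × ℤ × ℕ} (hp : p ∉ indexBox K) :
    K + 1 ≤ indexSize p := by
  by_contra! h
  refine hp ?_
  have h0 : (p.1 0).natAbs ≤ indexSize p := (le_max_left _ _).trans (le_max_left _ _)
  have h1 : (p.1 1).natAbs ≤ indexSize p := (le_max_right _ _).trans (le_max_left _ _)
  have h2 : p.2.1.natAbs ≤ indexSize p := (le_max_left _ _).trans (le_max_right _ _)
  have h3 : p.2.2 ≤ indexSize p := (le_max_right _ _).trans (le_max_right _ _)
  simp only [indexBox, Finset.mem_product, Fintype.mem_piFinset, Fin.forall_fin_two,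
    Finset.mem_Icc, Finset.mem_range]
  omega

theorem IsClassicalSymbol.exists_tail_decay (hL : 0 < L) (ha : IsClassicalSymbol m a b)
    (hb : TemperedGrowth b) (N : ℕ) : ∃ C : ℝ, 0 < C ∧ ∀ K : ℕ, ((K : ℝ) + 1) ^ N *
      ∑' p : {p // p ∉ indexBox K}, ‖interactionCoeff m L a p.1.1 p.1.2.1 p.1.2.2‖ ≤ C := by
  -- Outside the box the size exceeds K: N powers pay for (K + 1)^N and the other 8 for summability.
  obtain ⟨C, hC0, hC⟩ := ha.exists_cosineMoment_decay hL hb (N + 8)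
  have hZ := summable_indexSize.mul_left C
  have hZ0 : ∀ p : Lattice × ℤ × ℕ, 0 ≤ C * (((indexSize p : ℝ) + 1) ^ 8)⁻¹ :=
    fun p => by positivity
  refine ⟨∑' p : Lattice × ℤ × ℕ, C * (((indexSize p : ℝ) + 1) ^ 8)⁻¹ + 1, ?_, fun K => ?_⟩
  · have : 0 ≤ ∑' p : Lattice × ℤ × ℕ, C * (((indexSize p : ℝ) + 1) ^ 8)⁻¹ := tsum_nonneg hZ0
    linarith
  · rw [← tsum_mul_left]
    have hle : ∀ p : {p // p ∉ indexBox K}, ((K : ℝ) + 1) ^ N *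
        ‖interactionCoeff m L a p.1.1 p.1.2.1 p.1.2.2‖ ≤
          C * (((indexSize p.1 : ℝ) + 1) ^ 8)⁻¹ := by
      rintro ⟨p, hp⟩
      have h1 : (K : ℝ) + 1 ≤ (indexSize p : ℝ) + 1 := by
        have : ((K + 1 : ℕ) : ℝ) ≤ indexSize p := by exact_mod_cast indexSize_of_notMem hp
        push_cast at this
        linarith
      rw [← div_eq_mul_inv, le_div_iff₀ (by positivity)]
      calc _ ≤ ((indexSize p : ℝ) + 1) ^ N * ‖cosineMoment m L a (p.1, p.2.1) p.2.2‖ *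
            ((indexSize p : ℝ) + 1) ^ 8 := by
            gcongr
            exact norm_interactionCoeff_le m L a p
        _ = ((indexSize p : ℝ) + 1) ^ (N + 8) * ‖cosineMoment m L a (p.1, p.2.1) p.2.2‖ := by ring
        _ ≤ C := hC p
    have hsub := hZ.subtype {p | p ∉ indexBox K}
    have hsum := Summable.of_nonneg_of_le (fun p => by positivity) hle hsub
    refine (hsum.tsum_le_tsum hle hsub).trans ?_
    refine (Summable.tsum_subtype_le _ {p | p ∉ indexBox K} hZ0 hZ).trans ?_
    linarith

end Expansion

/-! ### Counting the retained indices -/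

section Counting

open Classical in
/-- For rapidly decreasing `c`, the least number of indices outside of which the sum of `c` is at
most `ε` is smaller than any negative power of `ε`. -/
theorem exists_sparse_approximation {α : Type*} {c : α → ℝ} (hc0 : ∀ p, 0 ≤ c p) (hc : Summable c)
    {B : ℕ → Finset α} (hB : ∀ K, (B K).card ≤ (2 * K + 1) ^ 4)
    (htail : ∀ N : ℕ, ∃ C : ℝ, 0 < C ∧ ∀ K : ℕ,
      ((K : ℝ) + 1) ^ N * ∑' p : {p // p ∉ B K}, c p ≤ C) :
    ∃ C : ℝ → ℝ, (∀ n : ℝ, 0 < n → 0 < C n) ∧ ∀ ε : ℝ, 0 < ε →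
      ∃ S : Finset α, (∀ n : ℝ, 0 < n → (S.card : ℝ) ≤ C n * ε ^ (-1 / n)) ∧
        ∑' p : {p // p ∉ S}, c p ≤ ε := by
  obtain ⟨σ, hσ0, hσ⟩ : ∃ σ : ℝ, 0 < σ ∧ ∑' p, c p < σ :=
    ⟨∑' p, c p + 1, by have : 0 ≤ ∑' p, c p := tsum_nonneg hc0; linarith, by linarith⟩
  have hkey : ∀ n : ℝ, 0 < n → ∃ C : ℝ, 0 < C ∧ ∀ ε : ℝ, 0 < ε → ε ≤ σ → ∃ S : Finset α,
      (S.card : ℝ) ≤ C * ε ^ (-1 / n) ∧ ∑' p : {p // p ∉ S}, c p ≤ ε := by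
    intro n hn
    -- A tail (K + 1)^{-N} calls for K of order ε^{-1/N}, hence of order ε^{-4/N} indices; N ≥ 4n
    -- brings this below ε^{-1/n}.
    obtain ⟨N, hN⟩ := exists_nat_ge (4 * n)
    have hN0 : (0 : ℝ) < N := by linarith
    obtain ⟨C₀, hC₀, hC⟩ := htail N
    -- The maximum with σ ensures C/ε ≥ 1 for ε ≤ σ, so that powers of C/ε increase with the
    -- exponent.
    set C := max C₀ σ
    have hC0 : 0 < C := hC₀.trans_le (le_max_left _ _)
    refine ⟨5 ^ 4 * C ^ (1 / n), by positivity, fun ε hε hεσ => ?_⟩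
    have hx : 1 ≤ C / ε := (one_le_div hε).2 (hεσ.trans (le_max_right _ _))
    set y := (C / ε) ^ (1 / (N : ℝ)) with hy
    have hy1 : 1 ≤ y := Real.one_le_rpow hx (by positivity)
    have hyN : y ^ N = C / ε := by
      rw [hy, ← Real.rpow_natCast, ← Real.rpow_mul (by positivity), one_div,
        inv_mul_cancel₀ hN0.ne', Real.rpow_one]
    refine ⟨B ⌈y⌉₊, ?_, ?_⟩
    · have h1 : ((⌈y⌉₊ : ℕ) : ℝ) < y + 1 := Nat.ceil_lt_add_one (by linarith)
      have h2 : ((B ⌈y⌉₊).card : ℝ) ≤ (2 * (⌈y⌉₊ : ℝ) + 1) ^ 4 := by exact_mod_cast hB ⌈y⌉₊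
      have h3 : y ^ 4 ≤ (C / ε) ^ (1 / n) := by
        rw [hy, ← Real.rpow_natCast, ← Real.rpow_mul (by positivity)]
        refine Real.rpow_le_rpow_of_exponent_le hx ?_
        rw [one_div_mul_eq_div, div_le_div_iff₀ hN0 hn]
        push_cast
        linarith
      calc _ ≤ (2 * (⌈y⌉₊ : ℝ) + 1) ^ 4 := h2
        -- Since y ≥ 1, 2⌈y⌉ + 1 ≤ 2y + 3 ≤ 5y.
        _ ≤ (5 * y) ^ 4 := by gcongr; linarith
        _ = 5 ^ 4 * y ^ 4 := by ring
        _ ≤ 5 ^ 4 * (C / ε) ^ (1 / n) := by gcongr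
        _ = _ := by
          rw [Real.div_rpow hC0.le hε.le, neg_div, Real.rpow_neg hε.le]
          ring
    · have h1 : C / ε ≤ ((⌈y⌉₊ : ℝ) + 1) ^ N := by
        rw [← hyN]
        gcongr
        exact (Nat.le_ceil y).trans (by linarith)
      have h2 : 0 ≤ ∑' p : {p // p ∉ B ⌈y⌉₊}, c p := tsum_nonneg fun p => hc0 p
      have h3 : C / ε * ∑' p : {p // p ∉ B ⌈y⌉₊}, c p ≤ C :=
        (mul_le_mul_of_nonneg_right h1 h2).trans ((hC _).trans (le_max_left _ _))
      rw [div_mul_eq_mul_div, div_le_iff₀ hε] at h3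
      exact le_of_mul_le_mul_left h3 hC0
  choose! C hCpos hC using hkey
  refine ⟨C, hCpos, fun ε hε => ?_⟩
  have hempty : σ < ε → ∑' p : {p // p ∉ (∅ : Finset α)}, c p ≤ ε := fun h =>
    (Summable.tsum_subtype_le c {p | p ∉ (∅ : Finset α)} hc0 hc).trans (by linarith)
  -- The boxes above depend on n. A set of least cardinality does not, and it is no larger than any
  -- of them; for ε > σ this least cardinality is 0.
  have hex : ∃ M : ℕ, ∃ S : Finset α, S.card = M ∧ ∑' p : {p // p ∉ S}, c p ≤ ε := by
    rcases lt_or_ge σ ε with h | h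
    · exact ⟨0, ∅, rfl, hempty h⟩
    · obtain ⟨S, -, hS⟩ := hC 1 one_pos ε hε h
      exact ⟨_, S, rfl, hS⟩
  obtain ⟨S, hScard, hS⟩ := Nat.find_spec hex
  refine ⟨S, fun n hn => ?_, hS⟩
  rw [hScard]
  rcases lt_or_ge σ ε with h | h
  · have : Nat.find hex = 0 := Nat.le_zero.1 (Nat.find_min' hex ⟨∅, rfl, hempty h⟩)
    rw [this, Nat.cast_zero]
    have := hCpos n hn
    positivity
  · obtain ⟨S', hcard', hS'⟩ := hC n hn ε hε h
    refine le_trans ?_ hcard'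
    exact_mod_cast Nat.find_min' hex ⟨S', rfl, hS'⟩

end Counting

/-! ### Elementary operators and their series -/

section Operators

/-- The plane wave as a bounded continuous function. -/
def waveBCF (k : Lattice) : BoundedContinuousFunction Plane ℂ :=
  BoundedContinuousFunction.ofNormedAddCommGroup (planeWave k) (continuous_planeWave k) 1
    fun x => (norm_planeWave k x).le

theorem norm_waveBCF_le (k : Lattice) : ‖waveBCF k‖ ≤ 1 :=
  BoundedContinuousFunction.norm_ofNormedAddCommGroup_le _ zero_le_one _

/-- Bounded continuous functions as elements of `L²([0,1]²)`. -/
abbrev bcfToL2 : BoundedContinuousFunction Plane ℂ →L[ℂ] SquareL2 :=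
  BoundedContinuousFunction.toLp 2 (volume.restrict unitSquare) ℂ

/-- The plane wave as an element of `L²([0,1]²)`. -/
def waveL2 (k : Lattice) : SquareL2 := bcfToL2 (waveBCF k)

theorem star_planeWave (k : Lattice) (x : Plane) :
    (starRingEnd ℂ) (planeWave k x) = planeWave (-k) x := by
  rw [planeWave, planeWave, ← Complex.exp_conj]
  congr 1
  simp only [map_mul, map_ofNat, Complex.conj_ofReal, Complex.conj_I, Pi.neg_apply, Int.cast_neg,
    neg_mul, Finset.sum_neg_distrib, Complex.ofReal_neg]
  ring

theorem orthonormal_waveL2 : Orthonormal ℂ waveL2 := by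
  rw [orthonormal_iff_ite]
  intro k l
  rw [waveL2, waveL2, BoundedContinuousFunction.inner_toLp]
  have : ∀ x, waveBCF l x * (starRingEnd ℂ) (waveBCF k x) = planeWave (l + -k) x := fun x => by
    rw [planeWave_add, ← star_planeWave]; rfl
  simp only [this, integral_planeWave, ← sub_eq_add_neg, sub_eq_zero, eq_comm]

/-- Multiplication of `ℓ²` families by a bounded family. -/
def lpMul (g : Lattice → ℂ) (hg : ∀ k, ‖g k‖ ≤ 1) :
    lp (fun _ : Lattice => ℂ) 2 →L[ℂ] lp (fun _ : Lattice => ℂ) 2 :=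
  LinearMap.mkContinuous
    { toFun := fun f => ⟨fun k => g k * f k, f.2.mono' fun k => by
        rw [norm_mul]; exact mul_le_of_le_one_left (norm_nonneg _) (hg k)⟩
      map_add' := fun f h => by ext k; exact mul_add _ _ _
      map_smul' := fun z f => by ext k; exact mul_left_comm _ _ _ } 1 (fun f => by
    rw [one_mul]
    refine lp.norm_mono two_ne_zero fun k => ?_
    change ‖g k * f k‖ ≤ ‖f k‖
    rw [norm_mul]
    exact mul_le_of_le_one_left (norm_nonneg _) (hg k))

theorem norm_lpMul_le (g : Lattice → ℂ) (hg : ∀ k, ‖g k‖ ≤ 1) : ‖lpMul g hg‖ ≤ 1 :=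
  LinearMap.mkContinuous_norm_le _ zero_le_one _

/-- The Fourier synthesis `(c_k) ↦ ∑ c_k e_{l + k}`. -/
def shiftedSynthesis (l : Lattice) : lp (fun _ : Lattice => ℂ) 2 →ₗᵢ[ℂ] SquareL2 :=
  ((orthonormal_waveL2.comp (fun k => l + k) (add_right_injective l)).orthogonalFamily).linearIsometry

theorem shiftedSynthesis_single (l k : Lattice) (z : ℂ) :
    shiftedSynthesis l (lp.single 2 k z) = z • waveL2 (l + k) := by
  rw [shiftedSynthesis, OrthogonalFamily.linearIsometry_apply_single]
  simp

/-- The isometry of `H^m` into `ℓ²`. -/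
def SobolevSpace.toL2Isometry (m : ℝ) : SobolevSpace m →ₗᵢ[ℂ] lp (fun _ : Lattice => ℂ) 2 where
  toLinearMap := SobolevSpace.toL2 m
  norm_map' _ := rfl

/-- The operator with symbol `e^{2π i x · l} g(ξ) ⟨ξ⟩^m`. -/
def elementaryOp (m : ℝ) (l : Lattice) (g : Lattice → ℂ) (hg : ∀ k, ‖g k‖ ≤ 1) :
    SobolevSpace m →L[ℂ] SquareL2 :=
  (shiftedSynthesis l).toContinuousLinearMap ∘L lpMul g hg ∘L
    (SobolevSpace.toL2Isometry m).toContinuousLinearMap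

/-- Multiplication by e^{2πi x·l} only shifts the orthonormal system, so two isometries surround a
multiplier bounded by 1. The bound is independent of l, so the operator error is controlled by
coefficients alone. -/
theorem norm_elementaryOp_le (m : ℝ) (l : Lattice) (g : Lattice → ℂ) (hg : ∀ k, ‖g k‖ ≤ 1) :
    ‖elementaryOp m l g hg‖ ≤ 1 := by
  refine ContinuousLinearMap.opNorm_le_bound _ zero_le_one fun f => ?_
  change ‖shiftedSynthesis l (lpMul g hg (SobolevSpace.toL2Isometry m f))‖ ≤ _
  rw [LinearIsometry.norm_map, ← (SobolevSpace.toL2Isometry m).norm_map f]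
  exact (lpMul g hg).le_of_opNorm_le (norm_lpMul_le g hg) _

/-- The trigonometric monomial `z e^{2π i x · k}` as an element of `H^m`. -/
def SobolevSpace.mode (m : ℝ) (k : Lattice) (z : ℂ) : SobolevSpace m :=
  ⟨Pi.single k z, by
    have h := lp.memℓp (lp.single (E := fun _ : Lattice => ℂ) 2 k
      (((bracket k.toPlane ^ m : ℝ) : ℂ) * z))
    refine h.mono' fun j => le_of_eq ?_
    rw [lp.coeFn_single]
    rcases eq_or_ne j k with rfl | hj
    · simp
    · simp [hj]⟩

theorem SobolevSpace.toL2_mode (m : ℝ) (k : Lattice) (z : ℂ) :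
    SobolevSpace.toL2 m (SobolevSpace.mode m k z) =
      lp.single 2 k (((bracket k.toPlane ^ m : ℝ) : ℂ) * z) := by
  ext j
  rw [lp.coeFn_single]
  change ((bracket j.toPlane ^ m : ℝ) : ℂ) * (Pi.single k z : Lattice → ℂ) j = _
  rcases eq_or_ne j k with rfl | hj
  · simp
  · simp [hj]

theorem SobolevSpace.hasSum_mode {m : ℝ} (f : SobolevSpace m) :
    HasSum (fun k => SobolevSpace.mode m k (f.coeff k)) f := by
  refine ((SobolevSpace.toL2Isometry m).isometry.isEmbedding.isInducing.hasSum_iff _ _).1 ?_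
  convert! lp.hasSum_single (p := 2) (by norm_num) (SobolevSpace.toL2 m f) using 1
  funext k
  exact SobolevSpace.toL2_mode m k (f.coeff k)

theorem elementaryOp_mode (m : ℝ) (l : Lattice) (g : Lattice → ℂ) (hg : ∀ k, ‖g k‖ ≤ 1)
    (k : Lattice) (z : ℂ) : elementaryOp m l g hg (SobolevSpace.mode m k z) =
      (g k * (((bracket k.toPlane ^ m : ℝ) : ℂ) * z)) • waveL2 (l + k) := by
  rw [← shiftedSynthesis_single]
  change shiftedSynthesis l (lpMul g hg (SobolevSpace.toL2 m _)) = _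
  rw [SobolevSpace.toL2_mode]
  congr 1
  ext j
  change g j * lp.single (E := fun _ : Lattice => ℂ) 2 k _ j = _
  rw [lp.coeFn_single, lp.coeFn_single]
  rcases eq_or_ne j k with rfl | hj
  · simp
  · simp [hj]

/-- An operator acting on the trigonometric monomials through a symbol is pseudodifferential. -/
theorem isPseudodifferential_of_mode {m : ℝ} {a : Plane → Plane → ℂ}
    {A : SobolevSpace m →L[ℂ] SquareL2}
    (h : ∀ k z, (A (SobolevSpace.mode m k z) : Plane → ℂ) =ᵐ[volume.restrict unitSquare]
      fun x => planeWave k x * a x k.toPlane * z) : IsPseudodifferential m a A :=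
  fun f => ⟨fun k => A (SobolevSpace.mode m k (f.coeff k)), fun k => h k _,
    A.hasSum f.hasSum_mode⟩

section Series

variable {P : Type*} {m : ℝ} {c : P → ℂ} {l : P → Lattice} {g : P → Lattice → ℂ}
  (hg : ∀ p k, ‖g p k‖ ≤ 1)

theorem norm_smul_elementaryOp_le (p : P) : ‖c p • elementaryOp m (l p) (g p) (hg p)‖ ≤ ‖c p‖ := by
  rw [norm_smul]
  exact mul_le_of_le_one_right (norm_nonneg _) (norm_elementaryOp_le _ _ _ _)

theorem summable_smul_elementaryOp (hc : Summable fun p => ‖c p‖) :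
    Summable fun p => c p • elementaryOp m (l p) (g p) (hg p) :=
  Summable.of_norm_bounded hc fun p => norm_smul_elementaryOp_le hg p

theorem norm_tsum_elementaryOp_le (hc : Summable fun p => ‖c p‖) :
    ‖∑' p, c p • elementaryOp m (l p) (g p) (hg p)‖ ≤ ∑' p, ‖c p‖ :=
  tsum_of_norm_bounded hc.hasSum fun p => norm_smul_elementaryOp_le hg p

/-- The sum of a series of elementary operators is the operator of the sum of the symbols. -/
theorem isPseudodifferential_tsum (hc : Summable fun p => ‖c p‖) {a : Plane → Plane → ℂ}
    (ha : ∀ x k, HasSum (fun p => c p * planeWave (l p) x * g p k *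
      ((bracket k.toPlane ^ m : ℝ) : ℂ)) (a x k.toPlane)) :
    IsPseudodifferential m a (∑' p, c p • elementaryOp m (l p) (g p) (hg p)) := by
  refine isPseudodifferential_of_mode fun k z => ?_
  -- On a single mode the series converges uniformly in x, not only in L². Its sum can therefore be
  -- evaluated pointwise and identified with the given symbol.
  let u : P → BoundedContinuousFunction Plane ℂ := fun p =>
    (c p * (g p k * (((bracket k.toPlane ^ m : ℝ) : ℂ) * z))) • waveBCF (l p + k)
  have hu : Summable u := by
    refine Summable.of_norm_bounded (hc.mul_right ‖((bracket k.toPlane ^ m : ℝ) : ℂ) * z‖)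
      fun p => ?_
    rw [norm_smul, norm_mul, norm_mul]
    calc _ ≤ ‖c p‖ * (1 * ‖((bracket k.toPlane ^ m : ℝ) : ℂ) * z‖) * 1 := by
          gcongr
          · exact hg p k
          · exact norm_waveBCF_le _
      _ = _ := by ring
  have h1 : (∑' p, c p • elementaryOp m (l p) (g p) (hg p)) (SobolevSpace.mode m k z) =
      bcfToL2 (∑' p, u p) := by
    have e1 := (ContinuousLinearMap.apply ℂ SquareL2 (SobolevSpace.mode m k z)).hasSum
      (summable_smul_elementaryOp (m := m) (l := l) hg hc).hasSum
    have e2 := bcfToL2.hasSum hu.hasSum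
    refine e1.unique ?_
    convert! e2 using 1
    funext p
    change c p • elementaryOp m (l p) (g p) (hg p) (SobolevSpace.mode m k z) = bcfToL2 (u p)
    rw [elementaryOp_mode, smul_smul, map_smul]
    rfl
  rw [h1]
  filter_upwards [BoundedContinuousFunction.coeFn_toLp 2 (volume.restrict unitSquare) ℂ
    (∑' p, u p)] with x hx
  rw [hx]
  have e3 := (BoundedContinuousFunction.evalCLM ℂ x).hasSum hu.hasSum
  refine e3.unique ?_
  convert! ((ha x k).mul_left (planeWave k x)).mul_right z using 1
  funext p
  change c p * (g p k * (((bracket k.toPlane ^ m : ℝ) : ℂ) * z)) * planeWave (l p + k) x = _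
  rw [planeWave_add]
  ring

end Series

end Operators

end SymbolCalculus

end

/-! ### The truncation theorem -/

open SymbolCalculus in
theorem theorem1 (m L : ℝ) (hL : 0 < L)
    (a : Plane → Plane → ℂ) (b : ℕ → Plane → ℝ → ℂ)
    (ha : IsClassicalSymbol m a b) (hb : TemperedGrowth b) :
    ∃ A : SobolevSpace m →L[ℂ] SquareL2, IsPseudodifferential m a A ∧
      ∃ C : ℝ → ℝ, (∀ n : ℝ, 0 < n → 0 < C n) ∧
        ∀ ε : ℝ, 0 < ε →
          ∃ M : ℕ, (∀ n : ℝ, 0 < n → (M : ℝ) ≤ C n * ε ^ (-1 / n)) ∧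
            ∃ S : Finset (Lattice × ℤ × ℕ), S.card ≤ M ∧
              ∃ A' : SobolevSpace m →L[ℂ] SquareL2,
                IsPseudodifferential m (truncatedExpansion m L a S) A' ∧ ‖A' - A‖ ≤ ε := by
  let c : Lattice × ℤ × ℕ → ℂ := fun p => interactionCoeff m L a p.1 p.2.1 p.2.2
  let g : Lattice × ℤ × ℕ → Lattice → ℂ := fun p k => freqBasis L p.2.1 p.2.2 k.toPlane
  have hg : ∀ p k, ‖g p k‖ ≤ 1 := fun p k => norm_freqBasis_le_one hL _ _ _
  have hc : Summable fun p => ‖c p‖ := ha.summable_norm_interactionCoeff hL hb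
  let T : Lattice × ℤ × ℕ → SobolevSpace m →L[ℂ] SquareL2 := fun p =>
    c p • elementaryOp m p.1 (g p) (hg p)
  have hT : Summable T := summable_smul_elementaryOp hg hc
  obtain ⟨C, hC0, hC⟩ := exists_sparse_approximation (fun p => norm_nonneg (c p)) hc
    card_indexBox_le (ha.exists_tail_decay hL hb)
  refine ⟨∑' p, T p, isPseudodifferential_tsum hg hc fun x k => ?_, C, hC0, fun ε hε => ?_⟩
  · have h := (ha.hasSum_expansion hL hb x k.toPlane).mul_right
      ((bracket k.toPlane ^ m : ℝ) : ℂ)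
    have hne : ((bracket k.toPlane ^ m : ℝ) : ℂ) ≠ 0 :=
      Complex.ofReal_ne_zero.2 (Real.rpow_pos_of_pos (bracket_pos _) m).ne'
    -- The expansion is that of ⟨ξ⟩^{-m} a; multiplying by ⟨ξ⟩^m restores a.
    rw [normalizedSymbol, Real.rpow_neg (bracket_pos _).le, Complex.ofReal_inv, mul_right_comm,
      inv_mul_cancel₀ hne, one_mul] at h
    exact h
  · obtain ⟨S, hScard, hS⟩ := hC ε hε
    refine ⟨S.card, hScard, S, le_rfl, ∑' p : {p // p ∈ S}, T p, ?_, ?_⟩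
    · refine isPseudodifferential_tsum (P := {p // p ∈ S}) (c := fun p => c p)
        (l := fun p => p.1.1) (g := fun p => g p) (fun p => hg p) (hc.subtype _) fun x k => ?_
      have h := hasSum_fintype fun p : {p // p ∈ S} => c p * planeWave p.1.1 x * g p k *
        ((bracket k.toPlane ^ m : ℝ) : ℂ)
      rwa [Finset.sum_coe_sort S fun p => c p * planeWave p.1 x * g p k *
        ((bracket k.toPlane ^ m : ℝ) : ℂ)] at h
    · have hsplit := hT.tsum_subtype_add_tsum_subtype_compl {p | p ∈ S}
      -- The error is itself a series of multiples of contractions over the discarded indices, so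
      -- its norm is at most the tail of the coefficients.
      have hdiff : ∑' p : {p // p ∈ S}, T p - ∑' p, T p = -∑' p : {p // p ∉ S}, T p := by
        rw [← hsplit]
        exact sub_add_cancel_left _ _
      rw [hdiff, norm_neg]
      exact (norm_tsum_elementaryOp_le (P := {p // p ∉ S}) (c := fun p => c p)
        (l := fun p => p.1.1) (g := fun p => g p) (fun p => hg p) (hc.subtype _)).trans hS
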